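/- Let $N \ge 1$ be an integer and let $\mathrm{d}U$ be the Haar probability measure on the unitary group $\mathrm{U}(N)$. For $z \in \mathbb{C}$ and $A,B \in \mathrm{Mat}_N(\mathbb{C})$ put $$I_N = \int_{\mathrm{U}(N)} e^{zN\operatorname{Tr}(AUBU^{-1})}\,\mathrm{d}U, \qquad J_N = \int_{\mathrm{U}(N)} e^{zN\operatorname{Tr}(AU+BU^{-1})}\,\mathrm{d}U.$$ *Notation.* For a Young diagram (partition) $\alpha \vdash d$ with $\ell(\alpha)$ rows of lengths $\alpha_i$, let $p_\alpha(x_1,\dots,x_N)=\prod_{i=1}^{\ell(\alpha)}\sum_{j=1}^N x_j^{\alpha_i}$, and let $C_\alpha \subset \mathrm{S}(d)$ be the conjugacy class of permutations of cycle type $\alpha$. For $\lambda \vdash d$ let $\mathsf{V}^\lambda$ be the corresponding irreducible complex representation of the symmetric group $\mathrm{S}(d)$, let $\chi_\alpha(\lambda)$ be the value of its character on $C_\alpha$, and let $$\omega_\alpha(\lambda) = \frac{|C_\alpha|\,\chi_\alpha(\lambda)}{\dim \mathsf{V}^\lambda}.$$ For $\lambda\vdash d$ with $\ell(\lambda)\le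 N$ let $\mathsf{W}^\lambda$ be the corresponding irreducible polynomial representation of $\mathrm{GL}_N(\mathbb{C})$ and let $$\Omega_N(\lambda) = \frac{d!}{N^d}\,\frac{\dim \mathsf{W}^\lambda}{\dim \mathsf{V}^\lambda}.$$ Let $\mathrm{S}_N(d)\subseteq \mathrm{S}(d)$ be the set of permutations with no increasing subsequence of length $N+1$, let $\mathbf{P}(\mathrm{LIS}_d\le N)=|\mathrm{S}_N(d)|/d!$ be the probability that a uniformly random permutation in $\mathrm{S}(d)$ lies in it, and for a function $f$ on the Young diagrams with $d$ cells and at most $N$ rows let $$\langle f\rangle = \sum_{\substack{\lambda\vdash d\\ \ell(\lambda)\le N}} f(\lambda)\,\frac{(\dim \mathsf{V}^\lambda)^2}{|\mathrm{S}_N(d)|}$$ be its expectation under the row-restricted Plancherel measure. *Theorem.* For all $z \in \mathbb{C}$ and $A,B\in\mathrm{Mat}_N(\mathbb{C})$, if $a_1,\dots,a_N$, $b_1,\dots,b_N$ and $c_1,\dots,c_N$ are the eigenvalues, with algebraic multiplicity, of $A$, $B$ and $C=AB$, respectively, then $$I_N = 1+\sum_{d=1}^\infty \frac{z^d}{d!}\,\mathbf{P}(\mathrm{LIS}_d\le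 N)\sum_{\alpha,\beta\vdash d} p_\alpha(a_1,\dots,a_N)\,p_\beta(b_1,\dots,b_N)\,\langle\omega_\alpha\Omega_N^{-1}\omega_\beta\rangle,$$ $$J_N = 1+\sum_{d=1}^\infty \frac{z^{2d}}{d!}\,N^d\,\mathbf{P}(\mathrm{LIS}_d\le N)\sum_{\beta\vdash d} p_\beta(c_1,\dots,c_N)\,\langle\Omega_N^{-1}\omega_\beta\rangle.$$ Moreover, these series in $d$ converge absolutely, and uniformly on compact subsets of $\mathbb{C}^{2N+1}$ (as functions of $(z,a_1,\dots,a_N,b_1,\dots,b_N)$) and of $\mathbb{C}^{N+1}$ (as functions of $(z,c_1,\dots,c_N)$), respectively. -/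

import Mathlib

open MeasureTheory Filter

noncomputable section

namespace StringExpansion

/-! ### Haar measure on the unitary group -/

/-- The compact group `U(N)` of `N × N` complex unitary matrices. -/
abbrev UGroup (N : ℕ) : Type := Matrix.unitaryGroup (Fin N) ℂ

instance instCompactSpaceUGroup (N : ℕ) : CompactSpace (UGroup N) := by
  refine isCompact_iff_compactSpace.1
    (?_ : IsCompact (↑(Matrix.unitaryGroup (Fin N) ℂ) : Set (Matrix (Fin N) (Fin N) ℂ)))
  have hK : IsCompact (Set.pi Set.univ (fun _ : Fin N =>
      Set.pi Set.univ (fun _ : Fin N => Metric.closedBall (0 : ℂ) 1))) :=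
    isCompact_univ_pi fun _ => isCompact_univ_pi fun _ => isCompact_closedBall _ _
  refine hK.of_isClosed_subset ?_ ?_
  · have h : (↑(Matrix.unitaryGroup (Fin N) ℂ) : Set (Matrix (Fin N) (Fin N) ℂ)) =
        {M | M * star M = 1} := by
      ext M
      exact Matrix.mem_unitaryGroup_iff
    rw [h]
    exact isClosed_eq (by fun_prop) continuous_const
  · intro M hM i _ j _
    simpa using entry_norm_bound_of_unitary hM i j

instance instMeasurableSpaceUGroup (N : ℕ) : MeasurableSpace (UGroup N) := borel _

instance instBorelSpaceUGroup (N : ℕ) : BorelSpace (UGroup N) := ⟨rfl⟩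

/-- Haar measure on `U(N)`, normalized to have total mass one. -/
def haarU (N : ℕ) : Measure (UGroup N) :=
  Measure.haarMeasure (⊤ : TopologicalSpace.PositiveCompacts (UGroup N))

/-- The Harish-Chandra/Itzykson-Zuber integral `∫ exp (z N Tr (A U B U⁻¹)) dU`. -/
def hciz (N : ℕ) (z : ℂ) (A B : Matrix (Fin N) (Fin N) ℂ) : ℂ :=
  ∫ U : UGroup N, Complex.exp (z * N * Matrix.trace
    (A * (U : Matrix (Fin N) (Fin N) ℂ) * B * ((U⁻¹ : UGroup N) : Matrix (Fin N) (Fin N) ℂ)))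
    ∂haarU N

/-- The Brézin-Gross-Witten integral `∫ exp (z N Tr (A U + B U⁻¹)) dU`. -/
def bgw (N : ℕ) (z : ℂ) (A B : Matrix (Fin N) (Fin N) ℂ) : ℂ :=
  ∫ U : UGroup N, Complex.exp (z * N * Matrix.trace
    (A * (U : Matrix (Fin N) (Fin N) ℂ) + B * ((U⁻¹ : UGroup N) : Matrix (Fin N) (Fin N) ℂ)))
    ∂haarU N

/-- `a` lists the eigenvalues of `A`, with algebraic multiplicity. -/
def IsEigenvalueList {N : ℕ} (A : Matrix (Fin N) (Fin N) ℂ) (a : Fin N → ℂ) : Prop :=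
  A.charpoly = ∏ i, (Polynomial.X - Polynomial.C (a i))

/-- The Newton power sum `p_α(x_1, …, x_N)`. -/
def powerSum {N d : ℕ} (α : d.Partition) (x : Fin N → ℂ) : ℂ :=
  MvPolynomial.eval x (MvPolynomial.psumPart (Fin N) ℂ α)

/-! ### Increasing subsequences -/

open scoped Classical in
/-- The length of the longest increasing subsequence of a permutation. -/
def lis {d : ℕ} (σ : Equiv.Perm (Fin d)) : ℕ :=
  (Finset.univ.filter fun s : Finset (Fin d) => StrictMonoOn σ (s : Set (Fin d))).sup Finset.card

/-- The permutations of `d` points with no increasing subsequence of length `N + 1`. -/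
def lisPerms (N d : ℕ) : Finset (Equiv.Perm (Fin d)) :=
  Finset.univ.filter fun σ => lis σ ≤ N

/-- The probability that a uniformly random permutation in `S(d)` has no increasing subsequence
of length `N + 1`. -/
def probLIS (N d : ℕ) : ℝ := ((lisPerms N d).card : ℝ) / (Nat.factorial d : ℝ)

/-! ### Irreducible representations of the symmetric group -/

/-- The group algebra of `S(d)`. -/
abbrev GroupAlg (d : ℕ) : Type := MonoidAlgebra ℂ (Equiv.Perm (Fin d))

/-- The row lengths of the Young diagram `lam`, in weakly decreasing order. The associated blocks
of `Fin d` are the rows of the tableau of shape `lam` numbered in reading order. -/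
def rows {d : ℕ} (lam : d.Partition) : Composition d where
  blocks := lam.parts.sort (· ≥ ·)
  blocks_pos := fun {i} hi => lam.parts_pos ((Multiset.mem_sort _).1 hi)
  blocks_sum := by
    rw [← Multiset.sum_coe, Multiset.sort_eq, lam.parts_sum]

/-- The row containing the entry `i` of the reading-order tableau of shape `lam`. -/
def rowOf {d : ℕ} (lam : d.Partition) (i : Fin d) : ℕ := ((rows lam).index i : ℕ)

/-- The column containing the entry `i` of the reading-order tableau of shape `lam`. -/
def colOf {d : ℕ} (lam : d.Partition) (i : Fin d) : ℕ := ((rows lam).invEmbedding i : ℕ)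

/-- The Young symmetrizer: the sum of the permutations that preserve rows, times the signed sum of
the permutations that preserve columns. -/
def youngSymmetrizer {d : ℕ} (lam : d.Partition) : GroupAlg d :=
  (∑ p : Equiv.Perm (Fin d) with ∀ i, rowOf lam (p i) = rowOf lam i,
      MonoidAlgebra.single p (1 : ℂ)) *
  (∑ q : Equiv.Perm (Fin d) with ∀ i, colOf lam (q i) = colOf lam i,
      MonoidAlgebra.single q (((Equiv.Perm.sign q : ℤˣ) : ℤ) : ℂ))

/-- The irreducible representation `V^lam` of `S(d)`, realized as the left ideal of the group
algebra generated by the Young symmetrizer. -/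
abbrev irrepV {d : ℕ} (lam : d.Partition) : Submodule (GroupAlg d) (GroupAlg d) :=
  Submodule.span (GroupAlg d) {youngSymmetrizer lam}

/-- The dimension of `V^lam`. -/
def dimV {d : ℕ} (lam : d.Partition) : ℕ := Module.finrank ℂ (irrepV lam)

/-- The character of `V^lam` at the permutation `σ`. -/
def character {d : ℕ} (lam : d.Partition) (σ : Equiv.Perm (Fin d)) : ℂ :=
  LinearMap.trace ℂ (irrepV lam)
    (Algebra.lsmul ℂ ℂ (irrepV lam) (MonoidAlgebra.of ℂ (Equiv.Perm (Fin d)) σ))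

/-- The conjugacy class `C_α` of permutations of cycle type `α` (fixed points included). -/
def conjClass {d : ℕ} (α : d.Partition) : Finset (Equiv.Perm (Fin d)) :=
  Finset.univ.filter fun σ => σ.partition.parts = α.parts

/-- The central character `ω_α(lam) = |C_α| χ_α(lam) / dim V^lam`; the product `|C_α| χ_α(lam)` is
written as the sum of the character, a class function, over `C_α`. -/
def omega {d : ℕ} (α lam : d.Partition) : ℂ :=
  (∑ σ ∈ conjClass α, character lam σ) / (dimV lam : ℂ)

/-! ### Irreducible polynomial representations of the general linear group -/

/-- The tensor space `(ℂ^N)^{⊗ d}`. -/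
abbrev TensorSpace (N d : ℕ) : Type := PiTensorProduct ℂ (fun _ : Fin d => Fin N → ℂ)

/-- The action of `S(d)` on `(ℂ^N)^{⊗ d}` by permutation of the tensor factors. -/
def permTensor (N d : ℕ) : Equiv.Perm (Fin d) →* Module.End ℂ (TensorSpace N d) where
  toFun σ := (PiTensorProduct.reindex ℂ (fun _ : Fin d => Fin N → ℂ) σ).toLinearMap
  map_one' := by
    ext x
    simp
    rfl
  map_mul' σ τ := by
    ext x
    simp
    rfl

/-- The irreducible polynomial representation `W^lam` of `GL_N(ℂ)`, realized as the image of the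
Young symmetrizer on `(ℂ^N)^{⊗ d}`, on which `g ∈ GL_N(ℂ)` acts as `g^{⊗ d}` (this commutes with
the Young symmetrizer). -/
abbrev irrepW (N : ℕ) {d : ℕ} (lam : d.Partition) : Submodule ℂ (TensorSpace N d) :=
  LinearMap.range (MonoidAlgebra.lift ℂ (Module.End ℂ (TensorSpace N d)) (Equiv.Perm (Fin d))
    (permTensor N d) (youngSymmetrizer lam))

/-- The dimension of `W^lam`. -/
def dimW (N : ℕ) {d : ℕ} (lam : d.Partition) : ℕ := Module.finrank ℂ (irrepW N lam)

/-- `Ω_N(lam) = (d! / N^d) (dim W^lam / dim V^lam)`. -/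
def Omega (N : ℕ) {d : ℕ} (lam : d.Partition) : ℂ :=
  ((Nat.factorial d : ℂ) / (N : ℂ) ^ d) * ((dimW N lam : ℂ) / (dimV lam : ℂ))

/-! ### String expansions -/

/-- The expectation `⟨f⟩` with respect to the row-restricted Plancherel measure, which gives mass
`(dim V^lam)² / |S_N(d)|` to each Young diagram with `d` cells and at most `N` rows. -/
def plancherel (N d : ℕ) (f : d.Partition → ℂ) : ℂ :=
  ∑ lam : d.Partition with lam.parts.card ≤ N,
    f lam * ((dimV lam : ℂ) ^ 2 / ((lisPerms N d).card : ℂ))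

/-- The degree `d` term of the string expansion of the HCIZ integral, as a function on
`ℂ^{2N+1}`. -/
def hcizTerm (N d : ℕ) (x : ℂ × (Fin N → ℂ) × (Fin N → ℂ)) : ℂ :=
  x.1 ^ d / (Nat.factorial d : ℂ) * (probLIS N d : ℂ) *
    ∑ α : d.Partition, ∑ β : d.Partition, powerSum α x.2.1 * powerSum β x.2.2 *
      plancherel N d (fun lam => omega α lam * (Omega N lam)⁻¹ * omega β lam)

/-- The degree `d` term of the string expansion of the BGW integral, as a function on
`ℂ^{N+1}`. -/
def bgwTerm (N d : ℕ) (x : ℂ × (Fin N → ℂ)) : ℂ :=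
  x.1 ^ (2 * d) / (Nat.factorial d : ℂ) * (N : ℂ) ^ d * (probLIS N d : ℂ) *
    ∑ β : d.Partition, powerSum β x.2 *
      plancherel N d (fun lam => (Omega N lam)⁻¹ * omega β lam)

/-- The series `∑_{d ≥ 1} f d` converges absolutely at each point, and both it and the series of
absolute values converge uniformly on every compact set. -/
def ConvergesAbsUnifOnCompacts {X : Type*} [TopologicalSpace X] (f : ℕ → X → ℂ) : Prop :=
  (∀ x, Summable fun d : ℕ => ‖f (d + 1) x‖) ∧
  ∀ K : Set X, IsCompact K →
    TendstoUniformlyOn (fun (n : ℕ) x => ∑ d ∈ Finset.range n, ‖f (d + 1) x‖)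
      (fun x => ∑' d : ℕ, ‖f (d + 1) x‖) atTop K ∧
    TendstoUniformlyOn (fun (n : ℕ) x => ∑ d ∈ Finset.range n, f (d + 1) x)
      (fun x => ∑' d : ℕ, f (d + 1) x) atTop K

end StringExpansion

end

open MeasureTheory Filter

noncomputable section

namespace StringExpansion

/-! ### Combinatorics of the reading-order tableau -/

/-! Expanding the exponentials reduces both formulas to moments over U(N), and every moment is a
trace on T = (ℂ^N)^{⊗d}: for instance Tr(AUBU⁻¹)^d is the trace of A^{⊗d} U^{⊗d} B^{⊗d} (U⁻¹)^{⊗d}.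
What is needed is therefore the average E(X) of the conjugates of a matrix X on T by U^{⊗d}. It
commutes with U(N), so by Schur-Weyl duality (`exists_rho_eq_of_comm_unitary`) it comes from the
group algebra of S(d). To find it, put Φ(X) = ∑ Tr(Xσ⁻¹)σ (`permTransform`). This map is blind to
conjugation by U^{⊗d}, and on the image of the group algebra it is multiplication by the central
element Φ(1), which is invertible there. Hence E(X) = Φ(1)⁻¹Φ(X), the Weingarten formula
(`unitaryAverage_eq`).

The central idempotents e_λ, built from the conjugates of the Young symmetrizers, diagonalize
everything: Φ(1) acts on the block of λ by d! dim W^λ / dim V^λ = N^d Ω_N(λ), and the sum over C_α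
acts by ω_α(λ) (`tensorCharacter_eq`, `classSum_eq`). Moreover the trace of A^{⊗d}σ is p_α(a) for σ
in C_α. This produces the sums over λ of (dim V^λ)³ / (d!² dim W^λ) ω_α(λ) ω_β(λ). For J_N, unequal
powers of Tr(AU) and Tr(BU⁻¹) integrate to zero, while equal powers become a sum of averages of
matrix units.

Increasing subsequences enter only through the normalization: |S_N(d)| in the probability cancels
|S_N(d)| in the Plancherel weights, so it need only be nonzero, and no Robinson-Schensted
correspondence is required. Diagrams with more than N rows drop out because W^λ vanishes. Finally,
each term of a series depends only on the eigenvalues, so it can be estimated with diagonal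
matrices; entries of unitary matrices are at most 1 in modulus, which gives bounds C^d/d! uniform on
compact sets. -/

lemma colOf_eq {d : ℕ} (lam : d.Partition) (i : Fin d) :
    colOf lam i = i - (rows lam).sizeUpTo (rowOf lam i) :=
  (rows lam).coe_invEmbedding i

lemma cell_injective {d : ℕ} (lam : d.Partition) {i j : Fin d}
    (hr : rowOf lam i = rowOf lam j) (hc : colOf lam i = colOf lam j) : i = j := by
  have h1 : (rows lam).sizeUpTo (rowOf lam i) ≤ i := (rows lam).sizeUpTo_index_le i
  have h2 : (rows lam).sizeUpTo (rowOf lam j) ≤ j := (rows lam).sizeUpTo_index_le j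
  rw [colOf_eq, colOf_eq] at hc
  rw [hr] at hc h1
  ext
  omega

lemma exists_cell_iff {d : ℕ} (lam : d.Partition) (r c : ℕ) :
    (∃ i, rowOf lam i = r ∧ colOf lam i = c) ↔
      ∃ h : r < (rows lam).blocks.length, c < (rows lam).blocks[r] := by
  constructor
  · rintro ⟨i, rfl, rfl⟩
    exact ⟨((rows lam).index i).2, ((rows lam).invEmbedding i).2⟩
  · rintro ⟨h, hc⟩
    refine ⟨(rows lam).embedding ⟨r, h⟩ ⟨c, hc⟩, ?_, ?_⟩
    · rw [rowOf, Composition.index_embedding]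
    · rw [colOf, Composition.invEmbedding_comp]

/-- Row lengths decrease weakly, so a column has no gaps. -/
lemma exists_cell_of_le {d : ℕ} (lam : d.Partition) (i : Fin d) {r : ℕ} (hr : r ≤ rowOf lam i) :
    ∃ j, rowOf lam j = r ∧ colOf lam j = colOf lam i := by
  obtain ⟨h, hc⟩ := (exists_cell_iff lam _ _).1 ⟨i, rfl, rfl⟩
  refine (exists_cell_iff lam _ _).2 ⟨hr.trans_lt h, hc.trans_le ?_⟩
  rcases hr.eq_or_lt with rfl | hlt
  · exact le_rfl
  · exact List.pairwise_iff_getElem.1 (Multiset.pairwise_sort lam.parts (· ≥ ·)) r _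
      (hr.trans_lt h) h hlt

lemma finset_eq_range_of_isLowerSet (s : Finset ℕ) (hs : ∀ a ∈ s, ∀ b ≤ a, b ∈ s) :
    s = Finset.range s.card := by
  refine Finset.eq_of_subset_of_card_le (fun a ha => ?_) (by simp)
  have h : Finset.range (a + 1) ⊆ s := fun b hb =>
    hs a ha b (Nat.lt_succ_iff.1 (Finset.mem_range.1 hb))
  have := Finset.card_le_card h
  simp only [Finset.card_range] at this
  exact Finset.mem_range.2 this

/-- The number of cells in column `j` of the diagram `lam`. -/
def colLength {d : ℕ} (lam : d.Partition) (j : ℕ) : ℕ :=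
  (Finset.univ.filter fun i => colOf lam i = j).card

lemma image_rowOf_column {d : ℕ} (lam : d.Partition) (j : ℕ) :
    (Finset.univ.filter fun i => colOf lam i = j).image (rowOf lam) =
      Finset.range (colLength lam j) := by
  have hinj : Set.InjOn (rowOf lam) (Finset.univ.filter fun i => colOf lam i = j) := by
    intro x hx y hy hxy
    simp only [Finset.coe_filter, Finset.mem_univ, true_and, Set.mem_ofPred_eq] at hx hy
    exact cell_injective lam hxy (hx.trans hy.symm)
  rw [colLength, ← Finset.card_image_of_injOn hinj]
  refine finset_eq_range_of_isLowerSet _ fun a ha b hb => ?_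
  simp only [Finset.mem_image, Finset.mem_filter, Finset.mem_univ, true_and] at ha ⊢
  obtain ⟨i, hi, rfl⟩ := ha
  obtain ⟨x, hx1, hx2⟩ := exists_cell_of_le lam i hb
  exact ⟨x, hx2.trans hi, hx1⟩

lemma exists_cell_of_lt_colLength {d : ℕ} (lam : d.Partition) {r j : ℕ}
    (h : r < colLength lam j) : ∃ i, rowOf lam i = r ∧ colOf lam i = j := by
  rw [← Finset.mem_range, ← image_rowOf_column] at h
  simp only [Finset.mem_image, Finset.mem_filter, Finset.mem_univ, true_and] at h
  obtain ⟨i, h1, h2⟩ := h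
  exact ⟨i, h2, h1⟩

/-- Since columns have no gaps, the diagram attains the upper bound that
`card_column_le_of_injective` gives for any arrangement separating rows from columns. Comparing the
two drives the dominance argument. -/
lemma card_column_rowOf_lt {d : ℕ} (lam : d.Partition) (k j : ℕ) :
    (Finset.univ.filter fun i => rowOf lam i < k ∧ colOf lam i = j).card =
      min k (colLength lam j) := by
  have hinj : Set.InjOn (rowOf lam)
      (Finset.univ.filter fun i => rowOf lam i < k ∧ colOf lam i = j) := by
    intro x hx y hy hxy
    simp only [Finset.coe_filter, Finset.mem_univ, true_and, Set.mem_ofPred_eq] at hx hy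
    exact cell_injective lam hxy (hx.2.trans hy.2.symm)
  rw [← Finset.card_image_of_injOn hinj, ← Finset.card_range (min k _)]
  congr 1
  ext r
  have := Finset.ext_iff.1 (image_rowOf_column lam j) r
  simp only [Finset.mem_image, Finset.mem_filter, Finset.mem_univ, true_and, Finset.mem_range,
    lt_min_iff] at this ⊢
  rw [← this]
  constructor
  · rintro ⟨i, ⟨h1, h2⟩, rfl⟩
    exact ⟨h1, i, h2, rfl⟩
  · rintro ⟨h1, i, h2, rfl⟩
    exact ⟨i, ⟨h1, h2⟩, rfl⟩

lemma card_column_le_of_injective {d : ℕ} {f h : Fin d → ℕ}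
    (hinj : ∀ i j, f i = f j → h i = h j → i = j) (k j : ℕ) :
    (Finset.univ.filter fun i => f i < k ∧ h i = j).card ≤
      min k (Finset.univ.filter fun i => h i = j).card := by
  refine le_min ?_ (Finset.card_le_card fun i hi => ?_)
  · rw [← Finset.card_range k]
    refine Finset.card_le_card_of_injOn f (fun i hi => ?_) fun x hx y hy hxy => ?_
    · simp only [Finset.coe_filter, Finset.mem_univ, true_and, Set.mem_ofPred_eq] at hi
      simpa using hi.1
    · simp only [Finset.coe_filter, Finset.mem_univ, true_and, Set.mem_ofPred_eq] at hx hy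
      exact hinj x y hxy (hx.2.trans hy.2.symm)
  · simp only [Finset.mem_filter, Finset.mem_univ, true_and] at hi ⊢
    exact hi.2

lemma card_lt_eq_sum_columns {d : ℕ} (f h : Fin d → ℕ) {M : ℕ} (hM : ∀ i, h i < M) (k : ℕ) :
    (Finset.univ.filter fun i => f i < k).card =
      ∑ j ∈ Finset.range M, (Finset.univ.filter fun i => f i < k ∧ h i = j).card := by
  rw [Finset.card_eq_sum_card_fiberwise (f := h) (t := Finset.range M)
    (fun i _ => by simpa using hM i)]
  simp only [Finset.filter_filter]

lemma colOf_lt {d : ℕ} (lam : d.Partition) (i : Fin d) : colOf lam i < d := by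
  rw [colOf_eq]
  omega

/-- `g` moves no two entries of a column of `mu` into a common row of `lam`. -/
def RowColSeparated {d : ℕ} (lam mu : d.Partition) (g : Equiv.Perm (Fin d)) : Prop :=
  ∀ i j, rowOf lam i = rowOf lam j → colOf mu (g⁻¹ i) = colOf mu (g⁻¹ j) → i = j

lemma card_colOf_comp_perm {d : ℕ} (mu : d.Partition) (g : Equiv.Perm (Fin d)) (j : ℕ) :
    (Finset.univ.filter fun i => colOf mu (g⁻¹ i) = j).card = colLength mu j := by
  rw [colLength]
  refine Finset.card_equiv g⁻¹ fun i => by simp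

/-- Dominance order: each column of `mu`, moved by `g`, puts at most min(k, its length) entries into
the first `k` rows of `lam`. Summed over the columns, this bound is exactly the number of cells in
the first `k` rows of `mu`. -/
lemma RowColSeparated.card_le {d : ℕ} {lam mu : d.Partition} {g : Equiv.Perm (Fin d)}
    (h : RowColSeparated lam mu g) (k : ℕ) :
    (Finset.univ.filter fun i => rowOf lam i < k).card ≤
      (Finset.univ.filter fun i => rowOf mu i < k).card := by
  rw [card_lt_eq_sum_columns (rowOf lam) (fun i => colOf mu (g⁻¹ i)) (fun i => colOf_lt mu _),
    card_lt_eq_sum_columns (rowOf mu) (colOf mu) (colOf_lt mu)]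
  refine Finset.sum_le_sum fun j _ => ?_
  refine (card_column_le_of_injective h k j).trans ?_
  rw [card_colOf_comp_perm, card_column_rowOf_lt]

/-- For equal shapes the dominance inequality is an equality, so it is an equality column by column.
With `k` the length of column `j`, this forces the whole moved column into the first `k` rows. -/
lemma RowColSeparated.rowOf_lt_colLength {d : ℕ} {lam : d.Partition} {g : Equiv.Perm (Fin d)}
    (h : RowColSeparated lam lam g) (i : Fin d) :
    rowOf lam i < colLength lam (colOf lam (g⁻¹ i)) := by
  set j := colOf lam (g⁻¹ i) with hj
  set k := colLength lam j
  have hle : ∀ j' ∈ Finset.range d,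
      (Finset.univ.filter fun i => rowOf lam i < k ∧ colOf lam (g⁻¹ i) = j').card ≤
      (Finset.univ.filter fun i => rowOf lam i < k ∧ colOf lam i = j').card := fun j' _ => by
    refine (card_column_le_of_injective h k j').trans ?_
    rw [card_colOf_comp_perm, card_column_rowOf_lt]
  have hsum := (Finset.sum_eq_sum_iff_of_le hle).1 (by
    rw [← card_lt_eq_sum_columns (rowOf lam) (fun i => colOf lam (g⁻¹ i))
      (fun i => colOf_lt lam _), ← card_lt_eq_sum_columns (rowOf lam) (colOf lam) (colOf_lt lam)])
    j (Finset.mem_range.2 (colOf_lt lam _))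
  rw [card_column_rowOf_lt, min_self] at hsum
  have heq : (Finset.univ.filter fun i => rowOf lam i < k ∧ colOf lam (g⁻¹ i) = j) =
      Finset.univ.filter fun i => colOf lam (g⁻¹ i) = j := by
    refine Finset.eq_of_subset_of_card_le (fun x hx => ?_) ?_
    · simp only [Finset.mem_filter, Finset.mem_univ, true_and] at hx ⊢
      exact hx.2
    · rw [hsum, card_colOf_comp_perm]
  have hi : i ∈ Finset.univ.filter fun i => colOf lam (g⁻¹ i) = j := by simp [hj]
  rw [← heq] at hi
  simp only [Finset.mem_filter, Finset.mem_univ, true_and] at hi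
  exact hi.1

/-- A permutation that separates rows from columns is a product of a row-preserving and a
column-preserving permutation. -/
lemma RowColSeparated.exists_factorization {d : ℕ} {lam : d.Partition} {g : Equiv.Perm (Fin d)}
    (h : RowColSeparated lam lam g) :
    ∃ p q : Equiv.Perm (Fin d), (∀ i, rowOf lam (p i) = rowOf lam i) ∧
      (∀ i, colOf lam (q i) = colOf lam i) ∧ g = p * q := by
  -- `φ i` is the cell in the row of `i` and the column of `g⁻¹ i`; the preceding lemma says that it
  -- lies in the diagram. Then `φ` preserves rows and `φ ∘ g` preserves columns.
  choose φ h1 h2 using fun i => exists_cell_of_lt_colLength lam (h.rowOf_lt_colLength i)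
  have hinj : Function.Injective φ := fun x y hxy =>
    h x y (by rw [← h1 x, ← h1 y, hxy]) (by rw [← h2 x, ← h2 y, hxy])
  set p : Equiv.Perm (Fin d) := Equiv.ofBijective φ (Finite.injective_iff_bijective.1 hinj)
  have hp : ∀ i, p i = φ i := fun _ => rfl
  refine ⟨p⁻¹, p * g, fun i => ?_, fun i => ?_, by group⟩
  · rw [← h1 (p⁻¹ i), ← hp]
    simp
  · rw [Equiv.Perm.mul_apply, hp, h2]
    simp

lemma rowOf_lt_iff {d : ℕ} (lam : d.Partition) (k : ℕ) (i : Fin d) :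
    rowOf lam i < k ↔ (i : ℕ) < (rows lam).sizeUpTo k := by
  constructor
  · intro h
    exact ((rows lam).lt_sizeUpTo_index_succ i).trans_le ((rows lam).monotone_sizeUpTo h)
  · intro h
    by_contra hk
    have := (rows lam).monotone_sizeUpTo (not_lt.1 hk)
    have h3 : (rows lam).sizeUpTo (rowOf lam i) ≤ i := (rows lam).sizeUpTo_index_le i
    omega

lemma card_rowOf_lt {d : ℕ} (lam : d.Partition) (k : ℕ) :
    (Finset.univ.filter fun i => rowOf lam i < k).card = (rows lam).sizeUpTo k := by
  simp only [rowOf_lt_iff]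
  rw [Fin.card_filter_val_lt, min_eq_right ((rows lam).sizeUpTo_le k)]

lemma list_eq_of_sum_take_eq : ∀ {l m : List ℕ}, (∀ x ∈ l, 0 < x) → (∀ x ∈ m, 0 < x) →
    (∀ k, (l.take k).sum = (m.take k).sum) → l = m
  | [], [], _, _, _ => rfl
  | [], b :: m, _, hm, h => by
    have := h 1
    have := hm b (by simp)
    simp at *
    omega
  | a :: l, [], hl, _, h => by
    have := h 1
    have := hl a (by simp)
    simp at *
    omega
  | a :: l, b :: m, hl, hm, h => by
    have hab : a = b := by simpa using h 1
    subst hab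
    exact congrArg (a :: ·) (list_eq_of_sum_take_eq (fun x hx => hl x (by simp [hx]))
      (fun x hx => hm x (by simp [hx])) fun k => by simpa using h (k + 1))

lemma partition_eq_of_card_rowOf_lt {d : ℕ} {lam mu : d.Partition}
    (h : ∀ k, (Finset.univ.filter fun i => rowOf lam i < k).card =
      (Finset.univ.filter fun i => rowOf mu i < k).card) : lam = mu := by
  have hb : (rows lam).blocks = (rows mu).blocks :=
    list_eq_of_sum_take_eq (fun x hx => (rows lam).blocks_pos hx)
      (fun x hx => (rows mu).blocks_pos hx) fun k => by
        have := h k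
        rwa [card_rowOf_lt, card_rowOf_lt] at this
  ext1
  rw [← Multiset.sort_eq lam.parts (· ≥ ·), ← Multiset.sort_eq mu.parts (· ≥ ·)]
  exact congrArg _ hb

lemma eq_of_rowColSeparated {d : ℕ} {lam mu : d.Partition} {g g' : Equiv.Perm (Fin d)}
    (h : RowColSeparated lam mu g) (h' : RowColSeparated mu lam g') : lam = mu :=
  partition_eq_of_card_rowOf_lt fun k => (h.card_le k).antisymm (h'.card_le k)

lemma card_parts_eq_colLength {d : ℕ} (lam : d.Partition) :
    lam.parts.card = colLength lam 0 := by
  have hlen : (rows lam).blocks.length = lam.parts.card := Multiset.length_sort _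
  rw [← Finset.card_range lam.parts.card, ← Finset.card_range (colLength lam 0),
    ← image_rowOf_column]
  congr 1
  ext r
  have h := exists_cell_iff lam r 0
  simp only [Finset.mem_range, Finset.mem_image, Finset.mem_filter, Finset.mem_univ, true_and]
  constructor
  · intro hr
    obtain ⟨i, h1, h2⟩ := h.2 ⟨hlen.symm ▸ hr, (rows lam).blocks_pos' r (hr.trans_eq hlen.symm)⟩
    exact ⟨i, h2, h1⟩
  · rintro ⟨i, h1, h2⟩
    obtain ⟨h3, -⟩ := h.1 ⟨i, h2, h1⟩
    exact hlen ▸ h3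

/-! ### Young symmetrizers and the center of the group algebra -/

/-- A permutation as an element of the group algebra. -/
abbrev basisPerm {d : ℕ} (g : Equiv.Perm (Fin d)) : GroupAlg d := MonoidAlgebra.single g 1

/-- The sum of the row-preserving permutations. -/
def rowSym {d : ℕ} (lam : d.Partition) : GroupAlg d :=
  ∑ p : Equiv.Perm (Fin d) with ∀ i, rowOf lam (p i) = rowOf lam i, basisPerm p

/-- The signed sum of the column-preserving permutations. -/
def colSym {d : ℕ} (lam : d.Partition) : GroupAlg d :=
  ∑ q : Equiv.Perm (Fin d) with ∀ i, colOf lam (q i) = colOf lam i,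
    MonoidAlgebra.single q (((Equiv.Perm.sign q : ℤˣ) : ℤ) : ℂ)

lemma youngSymmetrizer_eq {d : ℕ} (lam : d.Partition) :
    youngSymmetrizer lam = rowSym lam * colSym lam := rfl

lemma basisPerm_mul {d : ℕ} (g h : Equiv.Perm (Fin d)) :
    basisPerm g * basisPerm h = basisPerm (g * h) := by
  simp [basisPerm, MonoidAlgebra.single_mul_single]

lemma basisPerm_one {d : ℕ} : basisPerm (1 : Equiv.Perm (Fin d)) = 1 := rfl

lemma coeff_mul_basisPerm {d : ℕ} (x : GroupAlg d) (g h : Equiv.Perm (Fin d)) :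
    (x * basisPerm g).coeff h = x.coeff (h * g⁻¹) := by
  rw [MonoidAlgebra.coeff_mul_single_apply, mul_one]

lemma coeff_basisPerm_mul {d : ℕ} (x : GroupAlg d) (g h : Equiv.Perm (Fin d)) :
    (basisPerm g * x).coeff h = x.coeff (g⁻¹ * h) := by
  rw [MonoidAlgebra.coeff_single_mul_apply, one_mul]

lemma sum_coeff_smul_basisPerm {d : ℕ} (x : GroupAlg d) : ∑ g, x.coeff g • basisPerm g = x := by
  have h := (MonoidAlgebra.basis (Equiv.Perm (Fin d)) ℂ).sum_repr x
  simp only [MonoidAlgebra.basis_apply] at h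
  exact h

lemma rowSym_mul {d : ℕ} (lam : d.Partition) {p : Equiv.Perm (Fin d)}
    (hp : ∀ i, rowOf lam (p i) = rowOf lam i) : rowSym lam * basisPerm p = rowSym lam := by
  rw [rowSym, Finset.sum_mul]
  refine Finset.sum_equiv (Equiv.mulRight p) (fun g => ?_) fun g _ => by
    rw [basisPerm_mul, Equiv.coe_mulRight]
  simp only [Finset.mem_filter, Finset.mem_univ, true_and, Equiv.coe_mulRight,
    Equiv.Perm.mul_apply]
  constructor
  · intro h i
    rw [h, hp]
  · intro h i
    have h1 := h (p⁻¹ i)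
    have h2 := hp (p⁻¹ i)
    simp only [Equiv.Perm.inv_def, Equiv.apply_symm_apply] at h1 h2
    rw [h1, h2]

lemma mul_colSym {d : ℕ} (lam : d.Partition) {q : Equiv.Perm (Fin d)}
    (hq : ∀ i, colOf lam (q i) = colOf lam i) :
    basisPerm q * colSym lam = (((Equiv.Perm.sign q : ℤˣ) : ℤ) : ℂ) • colSym lam := by
  rw [colSym, Finset.mul_sum, Finset.smul_sum]
  refine Finset.sum_equiv (Equiv.mulLeft q) (fun g => ?_) fun g _ => ?_
  · simp only [Finset.mem_filter, Finset.mem_univ, true_and, Equiv.coe_mulLeft,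
      Equiv.Perm.mul_apply, hq]
  · rw [MonoidAlgebra.single_mul_single, MonoidAlgebra.smul_single, Equiv.coe_mulLeft, map_mul,
      one_mul, smul_eq_mul, Units.val_mul, Int.cast_mul, ← mul_assoc, ← Int.cast_mul,
      ← Units.val_mul, Int.units_mul_self, Units.val_one, Int.cast_one, one_mul]

/-- If `i ≠ j` share a row of `lam` while their preimages under `g` share a column of `mu`, the swap
of `i` and `j` is absorbed by the row sum. Carried past `g`, it becomes a swap absorbed by the
column sum with sign -1, so the product equals its own negative. -/
lemma rowSym_mul_colSym_eq_zero {d : ℕ} {lam mu : d.Partition} {g : Equiv.Perm (Fin d)}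
    (h : ¬ RowColSeparated lam mu g) : rowSym lam * basisPerm g * colSym mu = 0 := by
  simp only [RowColSeparated, not_forall] at h
  obtain ⟨i, j, hr, hc, hij⟩ := h
  have h1 : rowSym lam * basisPerm (Equiv.swap i j) = rowSym lam := by
    refine rowSym_mul lam fun x => ?_
    rcases eq_or_ne x i with rfl | hxi
    · rw [Equiv.swap_apply_left, hr]
    rcases eq_or_ne x j with rfl | hxj
    · rw [Equiv.swap_apply_right, hr]
    · rw [Equiv.swap_apply_of_ne_of_ne hxi hxj]
  have h2 : basisPerm (Equiv.swap (g⁻¹ i) (g⁻¹ j)) * colSym mu = -colSym mu := by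
    rw [mul_colSym, Equiv.Perm.sign_swap (by simpa using hij)]
    · simp
    intro x
    rcases eq_or_ne x (g⁻¹ i) with rfl | hxi
    · rw [Equiv.swap_apply_left, hc]
    rcases eq_or_ne x (g⁻¹ j) with rfl | hxj
    · rw [Equiv.swap_apply_right, hc]
    · rw [Equiv.swap_apply_of_ne_of_ne hxi hxj]
  have h3 : rowSym lam * basisPerm g * colSym mu = -(rowSym lam * basisPerm g * colSym mu) := by
    conv_lhs => rw [← h1, mul_assoc (rowSym lam), basisPerm_mul, Equiv.swap_mul_eq_mul_swap,
      ← basisPerm_mul, ← mul_assoc, mul_assoc, h2, mul_neg]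
  have h4 : (2 : ℂ) • (rowSym lam * basisPerm g * colSym mu) = 0 := by
    rw [two_smul]
    exact add_eq_zero_iff_eq_neg.2 h3
  exact (smul_eq_zero.1 h4).resolve_left two_ne_zero

lemma exists_rowSym_mul_basisPerm_mul_colSym {d : ℕ} (lam : d.Partition)
    (g : Equiv.Perm (Fin d)) :
    ∃ t : ℂ, rowSym lam * basisPerm g * colSym lam = t • youngSymmetrizer lam := by
  by_cases h : RowColSeparated lam lam g
  · obtain ⟨p, q, hp, hq, rfl⟩ := h.exists_factorization
    refine ⟨(((Equiv.Perm.sign q : ℤˣ) : ℤ) : ℂ), ?_⟩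
    rw [← basisPerm_mul, ← mul_assoc, rowSym_mul lam hp, mul_assoc, mul_colSym lam hq,
      mul_smul_comm, youngSymmetrizer_eq]
  · exact ⟨0, by rw [rowSym_mul_colSym_eq_zero h, zero_smul]⟩

lemma exists_rowSym_mul_mul_colSym {d : ℕ} (lam : d.Partition) (x : GroupAlg d) :
    ∃ t : ℂ, rowSym lam * x * colSym lam = t • youngSymmetrizer lam := by
  choose t ht using exists_rowSym_mul_basisPerm_mul_colSym lam
  refine ⟨∑ g, x.coeff g * t g, ?_⟩
  conv_lhs => rw [← sum_coeff_smul_basisPerm x]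
  simp only [Finset.mul_sum, Finset.sum_mul, mul_smul_comm, smul_mul_assoc, ht, smul_smul,
    Finset.sum_smul]

/-- A permutation preserving both rows and columns fixes every cell, so 1 = pq only for p = q = 1.
-/
lemma coeff_one_youngSymmetrizer {d : ℕ} (lam : d.Partition) :
    (youngSymmetrizer lam).coeff 1 = 1 := by
  rw [youngSymmetrizer_eq, rowSym, Finset.sum_mul, MonoidAlgebra.coeff_sum, Finset.sum_apply']
  rw [Finset.sum_eq_single 1]
  · rw [basisPerm_one, one_mul, colSym, MonoidAlgebra.coeff_sum, Finset.sum_apply',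
      Finset.sum_eq_single 1]
    · simp
    · intro q _ hq
      simp [hq]
    · simp
  · intro p hp hp1
    rw [coeff_basisPerm_mul, colSym, MonoidAlgebra.coeff_sum, Finset.sum_apply']
    refine Finset.sum_eq_zero fun q hq => ?_
    simp only [Finset.mem_filter, Finset.mem_univ, true_and] at hp hq
    rw [MonoidAlgebra.coeff_single, Finsupp.single_apply, if_neg]
    rintro rfl
    apply hp1
    ext1 i
    refine cell_injective lam (hp i) ?_
    have := hq (p i)
    simp only [mul_one, Equiv.Perm.inv_def, Equiv.symm_apply_apply] at this
    exact this.symm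
  · simp

/-- By the factorization of separating permutations, `rowSym * y * colSym` is always a multiple of
the Young symmetrizer; its coefficient at 1 identifies the multiple. -/
lemma youngSymmetrizer_mul_mul {d : ℕ} (lam : d.Partition) (x : GroupAlg d) :
    youngSymmetrizer lam * x * youngSymmetrizer lam =
      (youngSymmetrizer lam * x * youngSymmetrizer lam).coeff 1 • youngSymmetrizer lam := by
  obtain ⟨t, ht⟩ := exists_rowSym_mul_mul_colSym lam (colSym lam * x * rowSym lam)
  have h : youngSymmetrizer lam * x * youngSymmetrizer lam = t • youngSymmetrizer lam := by
    rw [← ht]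
    simp only [youngSymmetrizer_eq, mul_assoc]
  rw [h, MonoidAlgebra.coeff_smul, Finsupp.smul_apply, coeff_one_youngSymmetrizer, smul_eq_mul,
    mul_one]

lemma youngSymmetrizer_mul_mul_eq_zero {d : ℕ} {lam mu : d.Partition}
    (h : ∀ g, ¬ RowColSeparated lam mu g) (x : GroupAlg d) :
    youngSymmetrizer lam * x * youngSymmetrizer mu = 0 := by
  have h0 : ∀ y : GroupAlg d, rowSym lam * y * colSym mu = 0 := fun y => by
    rw [← sum_coeff_smul_basisPerm y]
    simp only [Finset.mul_sum, Finset.sum_mul, mul_smul_comm, smul_mul_assoc,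
      rowSym_mul_colSym_eq_zero (h _), smul_zero, Finset.sum_const_zero]
  rw [← h0 (colSym lam * x * rowSym mu)]
  simp only [youngSymmetrizer_eq, mul_assoc]

/-- The scalar by which the Young symmetrizer multiplies itself. -/
def youngScalar {d : ℕ} (lam : d.Partition) : ℂ :=
  (youngSymmetrizer lam * youngSymmetrizer lam).coeff 1

lemma youngSymmetrizer_mul_self {d : ℕ} (lam : d.Partition) :
    youngSymmetrizer lam * youngSymmetrizer lam = youngScalar lam • youngSymmetrizer lam := by
  have h := youngSymmetrizer_mul_mul lam 1
  rwa [mul_one] at h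

/-! ### Traces on the group algebra and on `V^lam`. -/

lemma trace_groupAlg {d : ℕ} (f : GroupAlg d →ₗ[ℂ] GroupAlg d) :
    LinearMap.trace ℂ _ f = ∑ g, (f (basisPerm g)).coeff g := by
  rw [LinearMap.trace_eq_matrix_trace ℂ (MonoidAlgebra.basis (Equiv.Perm (Fin d)) ℂ), Matrix.trace]
  refine Finset.sum_congr rfl fun g _ => ?_
  rw [Matrix.diag_apply, LinearMap.toMatrix_apply, MonoidAlgebra.basis_apply]
  rfl

lemma trace_mulRight_youngSymmetrizer {d : ℕ} (lam : d.Partition) :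
    LinearMap.trace ℂ _ (LinearMap.mulRight ℂ (youngSymmetrizer lam)) = (d.factorial : ℂ) := by
  rw [trace_groupAlg]
  simp only [LinearMap.mulRight_apply, coeff_basisPerm_mul, inv_mul_cancel,
    coeff_one_youngSymmetrizer]
  simp [Fintype.card_perm]

/-- Otherwise right multiplication by the Young symmetrizer would be nilpotent, although its trace
is d!. -/
lemma youngScalar_ne_zero {d : ℕ} (lam : d.Partition) : youngScalar lam ≠ 0 := by
  intro h
  have hn : IsNilpotent (LinearMap.mulRight ℂ (youngSymmetrizer lam)) := by
    refine ⟨2, LinearMap.ext fun x => ?_⟩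
    rw [pow_two, Module.End.mul_apply, LinearMap.mulRight_apply, LinearMap.mulRight_apply,
      mul_assoc, youngSymmetrizer_mul_self, h, zero_smul, mul_zero, LinearMap.zero_apply]
  have h0 := (LinearMap.isNilpotent_trace_of_isNilpotent hn).eq_zero
  rw [trace_mulRight_youngSymmetrizer] at h0
  exact Nat.cast_ne_zero.2 d.factorial_ne_zero h0

/-- The trace of the action of `x` on `V^lam`. -/
def traceV {d : ℕ} (lam : d.Partition) : GroupAlg d →ₗ[ℂ] ℂ :=
  LinearMap.trace ℂ (irrepV lam) ∘ₗ (Algebra.lsmul ℂ ℂ (irrepV lam)).toLinearMap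

lemma character_eq_traceV {d : ℕ} (lam : d.Partition) (σ : Equiv.Perm (Fin d)) :
    character lam σ = traceV lam (basisPerm σ) := rfl

lemma mem_irrepV_iff {d : ℕ} (lam : d.Partition) (v : GroupAlg d) :
    v ∈ irrepV lam ↔ v * youngSymmetrizer lam = youngScalar lam • v := by
  rw [Submodule.mem_span_singleton]
  constructor
  · rintro ⟨a, rfl⟩
    rw [smul_eq_mul, mul_assoc, youngSymmetrizer_mul_self, mul_smul_comm]
  · intro h
    refine ⟨(youngScalar lam)⁻¹ • v, ?_⟩
    rw [smul_eq_mul, smul_mul_assoc, h, inv_smul_smul₀ (youngScalar_ne_zero lam)]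

/-- Right multiplication by the Young symmetrizer, divided by `youngScalar`, projects the group
algebra onto `V^lam` and commutes with left multiplication. Cyclicity of the trace moves the
computation to the whole group algebra, where the permutations form a basis. -/
lemma traceV_eq {d : ℕ} (lam : d.Partition) (x : GroupAlg d) :
    traceV lam x = (youngScalar lam)⁻¹ * LinearMap.trace ℂ _
      (LinearMap.mulLeft ℂ x ∘ₗ LinearMap.mulRight ℂ (youngSymmetrizer lam)) := by
  let ι : irrepV lam →ₗ[ℂ] GroupAlg d := (irrepV lam).subtype.restrictScalars ℂ
  let π : GroupAlg d →ₗ[ℂ] irrepV lam :=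
    { toFun := fun y => ⟨(youngScalar lam)⁻¹ • (y * youngSymmetrizer lam), by
        rw [mem_irrepV_iff, smul_mul_assoc, mul_assoc, youngSymmetrizer_mul_self, mul_smul_comm,
          smul_comm]⟩
      map_add' := fun y z => by
        ext1
        simp [add_mul]
      map_smul' := fun r y => by
        ext1
        simp [smul_comm r] }
  have hι : ∀ v, ι v = v.1 := fun _ => rfl
  have hπ : ∀ y, (π y).1 = (youngScalar lam)⁻¹ • (y * youngSymmetrizer lam) := fun _ => rfl
  have hid : Algebra.lsmul ℂ ℂ (irrepV lam) x = π ∘ₗ (LinearMap.mulLeft ℂ x ∘ₗ ι) := by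
    refine LinearMap.ext fun v => Subtype.ext ?_
    rw [LinearMap.comp_apply, hπ, LinearMap.comp_apply, hι, LinearMap.mulLeft_apply, mul_assoc,
      (mem_irrepV_iff lam v.1).1 v.2, mul_smul_comm, inv_smul_smul₀ (youngScalar_ne_zero lam)]
    rfl
  change LinearMap.trace ℂ (irrepV lam) (Algebra.lsmul ℂ ℂ (irrepV lam) x) = _
  rw [hid, LinearMap.trace_comp_comm', LinearMap.comp_assoc, ← smul_eq_mul, ← map_smul]
  congr 1
  refine LinearMap.ext fun y => ?_
  simp only [LinearMap.comp_apply, hι, hπ, LinearMap.mulLeft_apply, LinearMap.smul_apply,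
    LinearMap.mulRight_apply, mul_smul_comm]

lemma traceV_one {d : ℕ} (lam : d.Partition) : traceV lam 1 = (dimV lam : ℂ) := by
  change LinearMap.trace ℂ (irrepV lam) (Algebra.lsmul ℂ ℂ (irrepV lam) 1) = _
  rw [map_one, LinearMap.trace_one, dimV]

lemma youngScalar_mul_dimV {d : ℕ} (lam : d.Partition) :
    youngScalar lam * dimV lam = (d.factorial : ℂ) := by
  rw [← traceV_one, traceV_eq, ← mul_assoc, mul_inv_cancel₀ (youngScalar_ne_zero lam), one_mul,
    LinearMap.mulLeft_one, LinearMap.id_comp, trace_mulRight_youngSymmetrizer]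

lemma dimV_ne_zero {d : ℕ} (lam : d.Partition) : (dimV lam : ℂ) ≠ 0 := by
  intro h
  have := youngScalar_mul_dimV lam
  rw [h, mul_zero] at this
  exact Nat.cast_ne_zero.2 d.factorial_ne_zero this.symm

/-- The sum of the conjugates of the Young symmetrizer. -/
def conjSum {d : ℕ} (lam : d.Partition) : GroupAlg d :=
  ∑ g, basisPerm g * youngSymmetrizer lam * basisPerm g⁻¹

lemma conjSum_comm {d : ℕ} (lam : d.Partition) (x : GroupAlg d) :
    x * conjSum lam = conjSum lam * x := by
  have h : ∀ h : Equiv.Perm (Fin d), basisPerm h * conjSum lam = conjSum lam * basisPerm h := by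
    intro h
    rw [conjSum, Finset.mul_sum, Finset.sum_mul]
    refine Fintype.sum_equiv (Equiv.mulLeft h) _ _ fun g => ?_
    rw [Equiv.coe_mulLeft, mul_assoc (_ * _) (basisPerm (h * g)⁻¹), basisPerm_mul, mul_inv_rev,
      inv_mul_cancel_right, ← mul_assoc, ← mul_assoc, basisPerm_mul]
  rw [← sum_coeff_smul_basisPerm x, Finset.mul_sum, Finset.sum_mul]
  simp only [smul_mul_assoc, mul_smul_comm, h]

lemma coeff_conjSum {d : ℕ} (lam : d.Partition) (σ : Equiv.Perm (Fin d)) :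
    (conjSum lam).coeff σ = youngScalar lam * character lam σ⁻¹ := by
  rw [character_eq_traceV, traceV_eq, ← mul_assoc, mul_inv_cancel₀ (youngScalar_ne_zero lam),
    one_mul, trace_groupAlg, conjSum, MonoidAlgebra.coeff_sum, Finset.sum_apply']
  refine Finset.sum_congr rfl fun g _ => ?_
  simp only [LinearMap.comp_apply, LinearMap.mulLeft_apply, LinearMap.mulRight_apply,
    coeff_mul_basisPerm, coeff_basisPerm_mul, inv_inv]

/-- Write c for the Young symmetrizer. The coefficient is the trace of x ↦ cxc. This map has image
in ℂc, so its trace is the scalar by which it acts on c, and c³ = `youngScalar`² c. -/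
lemma youngSymmetrizer_mul_conjSum_coeff_one {d : ℕ} (lam : d.Partition) :
    (youngSymmetrizer lam * conjSum lam).coeff 1 = youngScalar lam ^ 2 := by
  set c := youngSymmetrizer lam
  let f : GroupAlg d →ₗ[ℂ] GroupAlg d := LinearMap.mulRight ℂ c ∘ₗ LinearMap.mulLeft ℂ c
  have hf : ∀ x, f x = c * x * c := fun _ => rfl
  let φ : GroupAlg d →ₗ[ℂ] ℂ :=
    Finsupp.lapply 1 ∘ₗ (MonoidAlgebra.coeffLinearEquiv ℂ).toLinearMap ∘ₗ f
  have hφ : ∀ x, φ x = (c * x * c).coeff 1 := fun _ => rfl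
  have h1 : LinearMap.trace ℂ _ f = (c * conjSum lam).coeff 1 := by
    rw [trace_groupAlg, conjSum, Finset.mul_sum, MonoidAlgebra.coeff_sum, Finset.sum_apply']
    refine Finset.sum_congr rfl fun g _ => ?_
    rw [hf, ← mul_assoc, ← mul_assoc, coeff_mul_basisPerm, one_mul, inv_inv]
  have h2 : LinearMap.trace ℂ _ f = φ c := by
    rw [trace_groupAlg]
    conv_rhs => rw [← sum_coeff_smul_basisPerm c, map_sum]
    refine Finset.sum_congr rfl fun g _ => ?_
    rw [hf, youngSymmetrizer_mul_mul, map_smul, hφ, MonoidAlgebra.coeff_smul, Finsupp.smul_apply,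
      smul_eq_mul, smul_eq_mul, mul_comm]
  rw [← h1, h2, hφ, youngSymmetrizer_mul_self, smul_mul_assoc, youngSymmetrizer_mul_self, smul_smul,
    MonoidAlgebra.coeff_smul, Finsupp.smul_apply, coeff_one_youngSymmetrizer, smul_eq_mul, mul_one,
    pow_two]

/-- As `conjSum` is central and c² is a nonzero multiple of c, the product has the form cxc up to a
scalar, hence is a multiple of c. -/
lemma youngSymmetrizer_mul_conjSum {d : ℕ} (lam : d.Partition) :
    youngSymmetrizer lam * conjSum lam = youngScalar lam ^ 2 • youngSymmetrizer lam := by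
  set c := youngSymmetrizer lam with hc
  have h : c * conjSum lam = (youngScalar lam)⁻¹ • (c * conjSum lam * c) := by
    rw [mul_assoc, ← conjSum_comm, ← mul_assoc, youngSymmetrizer_mul_self, smul_mul_assoc,
      inv_smul_smul₀ (youngScalar_ne_zero lam)]
  have h2 : ∃ t : ℂ, c * conjSum lam = t • c :=
    ⟨_, by rw [h, hc, youngSymmetrizer_mul_mul, smul_smul]⟩
  obtain ⟨t, ht⟩ := h2
  have h3 := youngSymmetrizer_mul_conjSum_coeff_one lam
  rw [← hc, ht, MonoidAlgebra.coeff_smul, Finsupp.smul_apply, coeff_one_youngSymmetrizer,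
    smul_eq_mul, mul_one] at h3
  rw [ht, h3]

lemma conjSum_mul_conjSum_eq {d : ℕ} (lam mu : d.Partition) :
    conjSum lam * conjSum mu =
      ∑ g, basisPerm g * (youngSymmetrizer lam * conjSum mu) * basisPerm g⁻¹ := by
  rw [conjSum, Finset.sum_mul]
  refine Finset.sum_congr rfl fun g _ => ?_
  simp only [mul_assoc]
  rw [conjSum_comm]

lemma conjSum_mul_self {d : ℕ} (lam : d.Partition) :
    conjSum lam * conjSum lam = youngScalar lam ^ 2 • conjSum lam := by
  rw [conjSum_mul_conjSum_eq, youngSymmetrizer_mul_conjSum, conjSum, Finset.smul_sum]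
  simp only [mul_smul_comm, smul_mul_assoc]

lemma conjSum_mul_eq_zero_of_forall {d : ℕ} {lam mu : d.Partition}
    (h : ∀ x, youngSymmetrizer lam * x * youngSymmetrizer mu = 0) :
    conjSum lam * conjSum mu = 0 := by
  have h0 : youngSymmetrizer lam * conjSum mu = 0 := by
    rw [conjSum, Finset.mul_sum]
    refine Finset.sum_eq_zero fun g _ => ?_
    rw [← mul_assoc, ← mul_assoc, h, zero_mul]
  rw [conjSum_mul_conjSum_eq, h0]
  simp

/-- For distinct shapes, dominance excludes separating permutations in at least one of the two
directions; centrality makes either direction suffice. -/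
lemma conjSum_mul_of_ne {d : ℕ} {lam mu : d.Partition} (h : lam ≠ mu) :
    conjSum lam * conjSum mu = 0 := by
  by_cases h1 : ∃ g, RowColSeparated lam mu g
  · obtain ⟨g, hg⟩ := h1
    rw [conjSum_comm]
    exact conjSum_mul_eq_zero_of_forall (youngSymmetrizer_mul_mul_eq_zero
      fun g' hg' => h (eq_of_rowColSeparated hg hg'))
  · push Not at h1
    exact conjSum_mul_eq_zero_of_forall (youngSymmetrizer_mul_mul_eq_zero h1)

/-- The primitive central idempotent attached to `lam`. -/
def centralIdem {d : ℕ} (lam : d.Partition) : GroupAlg d :=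
  (youngScalar lam ^ 2)⁻¹ • conjSum lam

lemma centralIdem_comm {d : ℕ} (lam : d.Partition) (x : GroupAlg d) :
    x * centralIdem lam = centralIdem lam * x := by
  rw [centralIdem, mul_smul_comm, smul_mul_assoc, conjSum_comm]

lemma centralIdem_mul_self {d : ℕ} (lam : d.Partition) :
    centralIdem lam * centralIdem lam = centralIdem lam := by
  rw [centralIdem, mul_smul_comm, smul_mul_assoc, conjSum_mul_self,
    inv_smul_smul₀ (pow_ne_zero 2 (youngScalar_ne_zero lam))]

lemma centralIdem_mul_of_ne {d : ℕ} {lam mu : d.Partition} (h : lam ≠ mu) :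
    centralIdem lam * centralIdem mu = 0 := by
  rw [centralIdem, centralIdem, mul_smul_comm, smul_mul_assoc, conjSum_mul_of_ne h, smul_zero,
    smul_zero]

lemma centralIdem_mul_youngSymmetrizer {d : ℕ} (lam : d.Partition) :
    centralIdem lam * youngSymmetrizer lam = youngSymmetrizer lam := by
  rw [← centralIdem_comm, centralIdem, mul_smul_comm, youngSymmetrizer_mul_conjSum,
    inv_smul_smul₀ (pow_ne_zero 2 (youngScalar_ne_zero lam))]

lemma centralIdem_ne_zero {d : ℕ} (lam : d.Partition) : centralIdem lam ≠ 0 := by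
  intro h
  have h1 := centralIdem_mul_youngSymmetrizer lam
  rw [h, zero_mul] at h1
  have h2 := coeff_one_youngSymmetrizer lam
  rw [← h1] at h2
  simp at h2

/-- The sum of the permutations of cycle type `α`. -/
def classSum {d : ℕ} (α : d.Partition) : GroupAlg d := ∑ σ ∈ conjClass α, basisPerm σ

lemma mem_conjClass {d : ℕ} {α : d.Partition} {σ : Equiv.Perm (Fin d)} :
    σ ∈ conjClass α ↔ σ.partition.parts = α.parts := by
  simp [conjClass]

lemma sum_perm_eq_sum_conjClass {d : ℕ} {M : Type*} [AddCommMonoid M]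
    (f : Equiv.Perm (Fin d) → M) : ∑ σ, f σ = ∑ α : d.Partition, ∑ σ ∈ conjClass α, f σ := by
  -- `σ.partition` is a partition of `Fintype.card (Fin d)`; here it is repackaged as a partition of
  -- `d`.
  let cyc : Equiv.Perm (Fin d) → d.Partition := fun σ =>
    ⟨σ.partition.parts, σ.partition.parts_pos, by
      rw [σ.partition.parts_sum, Fintype.card_fin]⟩
  rw [← Finset.sum_fiberwise Finset.univ cyc f]
  refine Finset.sum_congr rfl fun α _ => Finset.sum_congr ?_ fun _ _ => rfl
  ext σ
  simp [mem_conjClass, cyc, Nat.Partition.ext_iff]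

lemma isConj_of_mem_conjClass {d : ℕ} {α : d.Partition} {σ τ : Equiv.Perm (Fin d)}
    (hσ : σ ∈ conjClass α) (hτ : τ ∈ conjClass α) : IsConj σ τ := by
  rw [mem_conjClass] at hσ hτ
  rw [Equiv.Perm.partition_eq_of_isConj, Nat.Partition.ext_iff, hσ, hτ]

lemma mem_conjClass_of_isConj {d : ℕ} {α : d.Partition} {σ τ : Equiv.Perm (Fin d)}
    (hσ : σ ∈ conjClass α) (h : IsConj σ τ) : τ ∈ conjClass α := by
  rw [mem_conjClass] at hσ ⊢
  rw [← hσ, Equiv.Perm.partition_eq_of_isConj.1 h]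

lemma inv_mem_conjClass {d : ℕ} {α : d.Partition} {σ : Equiv.Perm (Fin d)} :
    σ⁻¹ ∈ conjClass α ↔ σ ∈ conjClass α := by
  rw [mem_conjClass, mem_conjClass, Equiv.Perm.parts_partition, Equiv.Perm.parts_partition,
    Equiv.Perm.cycleType_inv, Equiv.Perm.support_inv]

lemma classSum_comm {d : ℕ} (α : d.Partition) (x : GroupAlg d) :
    x * classSum α = classSum α * x := by
  have h : ∀ h : Equiv.Perm (Fin d), basisPerm h * classSum α = classSum α * basisPerm h := by
    intro h
    rw [classSum, Finset.mul_sum, Finset.sum_mul]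
    refine Finset.sum_equiv (MulAut.conj h).toEquiv (fun σ => ?_) fun σ _ => ?_
    · have hc : IsConj σ ((MulAut.conj h) σ) := isConj_iff.2 ⟨h, rfl⟩
      exact ⟨fun hσ => mem_conjClass_of_isConj hσ hc,
        fun hσ => mem_conjClass_of_isConj hσ hc.symm⟩
    · rw [basisPerm_mul, basisPerm_mul]
      simp
  rw [← sum_coeff_smul_basisPerm x, Finset.mul_sum, Finset.sum_mul]
  simp only [smul_mul_assoc, mul_smul_comm, h]

lemma mem_span_classSum_of_forall_comm {d : ℕ} {x : GroupAlg d}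
    (hx : ∀ y, y * x = x * y) : x ∈ Submodule.span ℂ (Set.range (classSum (d := d))) := by
  have hcoeff : ∀ {σ τ : Equiv.Perm (Fin d)}, IsConj σ τ → x.coeff σ = x.coeff τ := by
    intro σ τ h
    obtain ⟨g, rfl⟩ := isConj_iff.1 h
    have := congrArg (fun z => z.coeff (g * σ)) (hx (basisPerm g))
    simp only [coeff_mul_basisPerm, coeff_basisPerm_mul] at this
    rwa [inv_mul_cancel_left] at this
  rw [← sum_coeff_smul_basisPerm x, sum_perm_eq_sum_conjClass]
  refine Submodule.sum_mem _ fun α _ => ?_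
  rcases (conjClass α).eq_empty_or_nonempty with h | ⟨σ₀, h₀⟩
  · rw [h]
    simp
  · have : ∑ σ ∈ conjClass α, x.coeff σ • basisPerm σ = x.coeff σ₀ • classSum α := by
      rw [classSum, Finset.smul_sum]
      refine Finset.sum_congr rfl fun σ hσ => ?_
      rw [hcoeff (isConj_of_mem_conjClass hσ h₀)]
    rw [this]
    exact Submodule.smul_mem _ _ (Submodule.subset_span ⟨α, rfl⟩)

lemma linearIndependent_centralIdem (d : ℕ) :
    LinearIndependent ℂ (centralIdem (d := d)) := by
  rw [Fintype.linearIndependent_iff]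
  intro t ht lam
  have h := congrArg (· * centralIdem lam) ht
  simp only [Finset.sum_mul, smul_mul_assoc, zero_mul] at h
  rw [Finset.sum_eq_single lam (fun mu _ hmu => by rw [centralIdem_mul_of_ne hmu, smul_zero])
    (by simp), centralIdem_mul_self] at h
  exact (smul_eq_zero.1 h).resolve_right (centralIdem_ne_zero lam)

/-- Both families are indexed by the partitions of `d`. The idempotents are independent and lie in
the span of the class sums, so counting dimensions gives equality. This shows that no block is
missing from the list. -/
lemma span_centralIdem (d : ℕ) : Submodule.span ℂ (Set.range (centralIdem (d := d))) =
    Submodule.span ℂ (Set.range (classSum (d := d))) := by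
  refine Submodule.eq_of_le_of_finrank_le ?_ ?_
  · rw [Submodule.span_le]
    rintro _ ⟨lam, rfl⟩
    exact mem_span_classSum_of_forall_comm (centralIdem_comm lam)
  · rw [finrank_span_eq_card (linearIndependent_centralIdem d)]
    exact finrank_range_le_card _

/-- A central element acts on each `V^lam` by a scalar, and these scalars determine it. -/
lemma eq_sum_smul_centralIdem {d : ℕ} {x : GroupAlg d} (hx : ∀ y, y * x = x * y) :
    x = ∑ lam, (traceV lam x / dimV lam) • centralIdem lam := by
  have hmem := mem_span_classSum_of_forall_comm hx
  rw [← span_centralIdem, Submodule.mem_span_range_iff_exists_fun] at hmem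
  obtain ⟨t, ht⟩ := hmem
  conv_lhs => rw [← ht]
  refine Finset.sum_congr rfl fun lam _ => ?_
  congr 1
  -- Multiplying by the Young symmetrizer isolates one block: `x` acts there by `t lam`, so its
  -- trace on `V^lam` is `t lam * dimV lam`.
  have hxc : x * youngSymmetrizer lam = t lam • youngSymmetrizer lam := by
    conv_lhs => rw [← centralIdem_mul_youngSymmetrizer lam, ← mul_assoc, ← ht]
    rw [Finset.sum_mul, Finset.sum_eq_single lam, smul_mul_assoc, centralIdem_mul_self,
      smul_mul_assoc, centralIdem_mul_youngSymmetrizer]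
    · intro mu _ hmu
      rw [smul_mul_assoc, centralIdem_mul_of_ne hmu, smul_zero]
    · simp
  have htr : traceV lam x = t lam * dimV lam := by
    have h1 : LinearMap.mulLeft ℂ x ∘ₗ LinearMap.mulRight ℂ (youngSymmetrizer lam) =
        t lam • LinearMap.mulRight ℂ (youngSymmetrizer lam) := by
      refine LinearMap.ext fun y => ?_
      rw [LinearMap.comp_apply, LinearMap.mulLeft_apply, LinearMap.mulRight_apply,
        LinearMap.smul_apply, LinearMap.mulRight_apply, ← mul_assoc, ← hx, mul_assoc, hxc,
        mul_smul_comm]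
    rw [traceV_eq, h1, map_smul, trace_mulRight_youngSymmetrizer, ← youngScalar_mul_dimV lam,
      smul_eq_mul]
    field_simp [youngScalar_ne_zero lam]
  rw [htr, mul_div_cancel_right₀ _ (dimV_ne_zero lam)]

lemma sum_centralIdem (d : ℕ) : ∑ lam : d.Partition, centralIdem lam = 1 := by
  conv_rhs => rw [eq_sum_smul_centralIdem (x := (1 : GroupAlg d)) (by simp)]
  refine Finset.sum_congr rfl fun lam _ => ?_
  rw [traceV_one, div_self (dimV_ne_zero lam), one_smul]

lemma classSum_eq {d : ℕ} (α : d.Partition) :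
    classSum α = ∑ lam, omega α lam • centralIdem lam := by
  conv_lhs => rw [eq_sum_smul_centralIdem (classSum_comm α)]
  refine Finset.sum_congr rfl fun lam _ => ?_
  rw [omega, classSum, map_sum]
  rfl

lemma coeff_centralIdem {d : ℕ} (lam : d.Partition) (σ : Equiv.Perm (Fin d)) :
    (centralIdem lam).coeff σ = (youngScalar lam)⁻¹ * character lam σ⁻¹ := by
  rw [centralIdem, MonoidAlgebra.coeff_smul, Finsupp.smul_apply, coeff_conjSum, smul_eq_mul]
  field_simp [youngScalar_ne_zero lam]

lemma sum_conjClass_coeff_centralIdem {d : ℕ} (α lam : d.Partition) :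
    ∑ σ ∈ conjClass α, (centralIdem lam).coeff σ =
      (dimV lam : ℂ) ^ 2 / d.factorial * omega α lam := by
  simp only [coeff_centralIdem]
  rw [← Finset.mul_sum, Finset.sum_equiv (Equiv.inv _) (t := conjClass α)
    (g := fun σ => character lam σ) (fun σ => by simp [inv_mem_conjClass]) (fun σ _ => by simp),
    omega, ← youngScalar_mul_dimV lam]
  field_simp [youngScalar_ne_zero lam, dimV_ne_zero lam]

/-! ### Tensor space in coordinates -/

/-- The index set of the standard basis of `(ℂ^N)^{⊗ d}`. -/
abbrev TIndex (N d : ℕ) : Type := Fin d → Fin N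

/-- The matrices of the permutations of tensor factors. -/
def permMat (N d : ℕ) : Equiv.Perm (Fin d) →* Matrix (TIndex N d) (TIndex N d) ℂ where
  -- Precomposing row indices with `σ` keeps the order of products, and agrees with `permTensor` in
  -- the standard basis.
  toFun σ := Matrix.of fun i j => if i ∘ σ = j then 1 else 0
  map_one' := by
    ext i j
    simp [Matrix.one_apply]
  map_mul' σ τ := by
    ext i j
    simp only [Matrix.of_apply, Matrix.mul_apply, ite_mul, one_mul, zero_mul]
    simp
    rfl

lemma permMat_apply {N d : ℕ} (σ : Equiv.Perm (Fin d)) (i j : TIndex N d) :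
    permMat N d σ i j = if i ∘ σ = j then 1 else 0 := rfl

lemma permMat_mul_apply {N d : ℕ} (σ : Equiv.Perm (Fin d))
    (X : Matrix (TIndex N d) (TIndex N d) ℂ) (i j : TIndex N d) :
    (permMat N d σ * X) i j = X (i ∘ σ) j := by
  simp [Matrix.mul_apply, permMat_apply]

lemma comp_perm_eq_iff {N d : ℕ} (σ : Equiv.Perm (Fin d)) (k j : TIndex N d) :
    k ∘ σ = j ↔ k = j ∘ ⇑σ⁻¹ := by
  constructor
  · rintro rfl
    ext x
    simp
  · rintro rfl
    ext x
    simp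

lemma mul_permMat_apply {N d : ℕ} (σ : Equiv.Perm (Fin d))
    (X : Matrix (TIndex N d) (TIndex N d) ℂ) (i j : TIndex N d) :
    (X * permMat N d σ) i j = X i (j ∘ ⇑σ⁻¹) := by
  simp only [Matrix.mul_apply, permMat_apply, comp_perm_eq_iff, mul_ite, mul_one, mul_zero]
  simp

/-- The action of the group algebra on tensor space, in coordinates. -/
def rho (N d : ℕ) : GroupAlg d →ₐ[ℂ] Matrix (TIndex N d) (TIndex N d) ℂ :=
  MonoidAlgebra.lift ℂ _ (Equiv.Perm (Fin d)) (permMat N d)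

lemma rho_basisPerm {N d : ℕ} (σ : Equiv.Perm (Fin d)) :
    rho N d (basisPerm σ) = permMat N d σ := by
  simp [rho, MonoidAlgebra.lift_single]

/-- The standard basis of tensor space. -/
def tensorBasis (N d : ℕ) : Module.Basis (TIndex N d) ℂ (TensorSpace N d) :=
  Basis.piTensorProduct fun _ => Pi.basisFun ℂ (Fin N)

lemma toMatrix_permTensor {N d : ℕ} (σ : Equiv.Perm (Fin d)) :
    LinearMap.toMatrix (tensorBasis N d) (tensorBasis N d) (permTensor N d σ) = permMat N d σ := by
  ext i j
  have h : permTensor N d σ (tensorBasis N d j) = tensorBasis N d (j ∘ ⇑σ⁻¹) := by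
    simp only [tensorBasis, Basis.piTensorProduct_apply]
    exact PiTensorProduct.reindex_tprod _ _
  rw [LinearMap.toMatrix_apply, h, Module.Basis.repr_self, permMat_apply, Finsupp.single_apply]
  exact if_congr (eq_comm.trans (comp_perm_eq_iff σ i j).symm) rfl rfl

/-- The action of the group algebra on tensor space. -/
abbrev tensorAction (N d : ℕ) : GroupAlg d →ₐ[ℂ] Module.End ℂ (TensorSpace N d) :=
  MonoidAlgebra.lift ℂ (Module.End ℂ (TensorSpace N d)) (Equiv.Perm (Fin d)) (permTensor N d)

lemma toMatrix_tensorAction {N d : ℕ} (x : GroupAlg d) :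
    LinearMap.toMatrix (tensorBasis N d) (tensorBasis N d) (tensorAction N d x) = rho N d x := by
  have h : (LinearMap.toMatrixAlgEquiv (tensorBasis N d)).toAlgHom.comp (tensorAction N d) =
      rho N d := by
    refine MonoidAlgebra.algHom_ext (fun σ => ?_) (Subsingleton.elim _ _)
    rw [AlgHom.comp_apply, rho_basisPerm, ← toMatrix_permTensor]
    simp only [tensorAction, MonoidAlgebra.lift_single, one_smul]
    rfl
  exact DFunLike.congr_fun h x

lemma dimW_eq {d : ℕ} (N : ℕ) (lam : d.Partition) :
    dimW N lam =
      Module.finrank ℂ (LinearMap.range (Matrix.toLin' (rho N d (youngSymmetrizer lam)))) := by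
  let e := (tensorBasis N d).equivFun
  have h : Matrix.toLin' (rho N d (youngSymmetrizer lam)) ∘ₗ e.toLinearMap =
      e.toLinearMap ∘ₗ tensorAction N d (youngSymmetrizer lam) := by
    refine LinearMap.ext fun v => ?_
    rw [← toMatrix_tensorAction]
    exact LinearMap.toMatrix_mulVec_repr (tensorBasis N d) (tensorBasis N d) _ v
  have hr : LinearMap.range (Matrix.toLin' (rho N d (youngSymmetrizer lam))) =
      (LinearMap.range (tensorAction N d (youngSymmetrizer lam))).map e.toLinearMap := by
    rw [← LinearMap.range_comp, ← h]
    exact (LinearMap.range_comp_of_range_eq_top _ e.range).symm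
  rw [hr]
  exact (e.submoduleMap _).finrank_eq

/-- Divided by `youngScalar`, the Young symmetrizer acts on tensor space as a projection onto
`W^lam`, and the trace of a projection is its rank. -/
lemma youngScalar_mul_dimW {d : ℕ} (N : ℕ) (lam : d.Partition) :
    youngScalar lam * dimW N lam = (rho N d (youngSymmetrizer lam)).trace := by
  set f := Matrix.toLin' (rho N d (youngSymmetrizer lam)) with hf
  have hff : ∀ v, f (f v) = youngScalar lam • f v := fun v => by
    rw [← LinearMap.comp_apply, hf, ← Matrix.toLin'_mul, ← map_mul, youngSymmetrizer_mul_self,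
      map_smul, map_smul, LinearMap.smul_apply]
  have hproj : LinearMap.IsProj (LinearMap.range f) ((youngScalar lam)⁻¹ • f) := by
    refine ⟨fun v => ⟨(youngScalar lam)⁻¹ • v, by simp⟩, ?_⟩
    rintro _ ⟨v, rfl⟩
    rw [LinearMap.smul_apply, hff, inv_smul_smul₀ (youngScalar_ne_zero lam)]
  have h := hproj.trace
  rw [map_smul, hf, Matrix.trace_toLin'_eq, smul_eq_mul] at h
  rw [dimW_eq, ← h, mul_inv_cancel_left₀ (youngScalar_ne_zero lam)]

lemma trace_rho_centralIdem {d : ℕ} (N : ℕ) (lam : d.Partition) :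
    (rho N d (centralIdem lam)).trace = (dimV lam : ℂ) * dimW N lam := by
  have h : (rho N d (conjSum lam)).trace = d.factorial * (rho N d (youngSymmetrizer lam)).trace := by
    rw [conjSum, map_sum, Matrix.trace_sum]
    have : ∀ g : Equiv.Perm (Fin d),
        (rho N d (basisPerm g * youngSymmetrizer lam * basisPerm g⁻¹)).trace =
          (rho N d (youngSymmetrizer lam)).trace := fun g => by
      rw [map_mul, Matrix.trace_mul_comm, ← map_mul, ← mul_assoc, basisPerm_mul, inv_mul_cancel,
        basisPerm_one, one_mul]
    simp only [this, Finset.sum_const, Finset.card_univ, Fintype.card_perm, Fintype.card_fin,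
      nsmul_eq_mul]
  rw [centralIdem, map_smul, Matrix.trace_smul, h, ← youngScalar_mul_dimW,
    ← youngScalar_mul_dimV lam, smul_eq_mul]
  field_simp [youngScalar_ne_zero lam]

lemma youngSymmetrizer_rho_eq_zero {d N : ℕ} {lam : d.Partition} (h : dimW N lam = 0) :
    rho N d (youngSymmetrizer lam) = 0 := by
  rw [dimW_eq, Submodule.finrank_eq_zero, LinearMap.range_eq_bot] at h
  exact (LinearEquiv.map_eq_zero_iff _).1 h

lemma rho_centralIdem_eq_zero {d N : ℕ} {lam : d.Partition} (h : dimW N lam = 0) :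
    rho N d (centralIdem lam) = 0 := by
  rw [centralIdem, conjSum, map_smul, map_sum]
  simp [youngSymmetrizer_rho_eq_zero h]

/-- The first column has more than `N` cells, so two of its positions carry the same index in the
tuple `i`. Swapping them fixes `i` but changes the sign of the column sum. -/
lemma rho_colSym_eq_zero {d N : ℕ} {lam : d.Partition} (h : N < lam.parts.card) :
    rho N d (colSym lam) = 0 := by
  ext i j
  obtain ⟨x, hx, y, hy, hxy, hi⟩ := Finset.exists_ne_map_eq_of_card_lt_of_maps_to
    (s := Finset.univ.filter fun x => colOf lam x = 0) (t := Finset.univ) (f := i)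
    (by rw [Finset.card_univ, Fintype.card_fin]; exact h.trans_eq (card_parts_eq_colLength lam))
    (fun _ _ => by simp)
  simp only [Finset.mem_filter, Finset.mem_univ, true_and] at hx hy
  have hs : basisPerm (Equiv.swap x y) * colSym lam = -colSym lam := by
    rw [mul_colSym, Equiv.Perm.sign_swap hxy]
    · simp
    intro z
    rcases eq_or_ne z x with rfl | hzx
    · rw [Equiv.swap_apply_left, hx, hy]
    rcases eq_or_ne z y with rfl | hzy
    · rw [Equiv.swap_apply_right, hx, hy]
    · rw [Equiv.swap_apply_of_ne_of_ne hzx hzy]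
  have hs' := congrArg (fun M => rho N d M i j) hs
  simp only [map_mul, map_neg, rho_basisPerm, permMat_mul_apply, Matrix.neg_apply] at hs'
  have hcomp : i ∘ Equiv.swap x y = i := by
    ext1 z
    rw [Function.comp_apply]
    rcases eq_or_ne z x with rfl | hzx
    · rw [Equiv.swap_apply_left, hi]
    rcases eq_or_ne z y with rfl | hzy
    · rw [Equiv.swap_apply_right, hi]
    · rw [Equiv.swap_apply_of_ne_of_ne hzx hzy]
  rw [hcomp] at hs'
  exact self_eq_neg.1 hs'

lemma dimW_eq_zero {d N : ℕ} {lam : d.Partition} (h : N < lam.parts.card) : dimW N lam = 0 := by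
  have h1 := youngScalar_mul_dimW N lam
  rw [youngSymmetrizer_eq, map_mul, rho_colSym_eq_zero h, mul_zero, Matrix.trace_zero] at h1
  exact_mod_cast (mul_eq_zero.1 h1).resolve_left (youngScalar_ne_zero lam)

/-- The `d`-th tensor power of a matrix. -/
def tensorPow (d : ℕ) {N : ℕ} (A : Matrix (Fin N) (Fin N) ℂ) :
    Matrix (TIndex N d) (TIndex N d) ℂ :=
  Matrix.of fun i j => ∏ r, A (i r) (j r)

lemma tensorPow_apply {d N : ℕ} (A : Matrix (Fin N) (Fin N) ℂ) (i j : TIndex N d) :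
    tensorPow d A i j = ∏ r, A (i r) (j r) := rfl

lemma tensorPow_mul {d N : ℕ} (A B : Matrix (Fin N) (Fin N) ℂ) :
    tensorPow d (A * B) = tensorPow d A * tensorPow d B := by
  ext i j
  simp only [tensorPow_apply, Matrix.mul_apply, ← Finset.prod_mul_distrib]
  rw [Finset.prod_univ_sum, Fintype.piFinset_univ]

lemma tensorPow_one {d N : ℕ} : tensorPow d (1 : Matrix (Fin N) (Fin N) ℂ) = 1 := by
  ext i j
  rw [tensorPow_apply, Matrix.one_apply]
  simp only [Matrix.one_apply]
  rw [Fintype.prod_ite_zero]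
  simp [funext_iff]

lemma trace_tensorPow {d N : ℕ} (A : Matrix (Fin N) (Fin N) ℂ) :
    (tensorPow d A).trace = A.trace ^ d := by
  have h := Finset.prod_univ_sum (fun _ : Fin d => (Finset.univ : Finset (Fin N)))
    (fun _ j => A j j)
  rw [Fintype.piFinset_univ] at h
  simp only [Matrix.trace, Matrix.diag_apply, tensorPow_apply]
  rw [← h]
  simp

lemma tensorPow_mul_permMat {d N : ℕ} (A : Matrix (Fin N) (Fin N) ℂ) (σ : Equiv.Perm (Fin d)) :
    tensorPow d A * permMat N d σ = permMat N d σ * tensorPow d A := by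
  ext i j
  rw [mul_permMat_apply, permMat_mul_apply, tensorPow_apply, tensorPow_apply]
  exact (Fintype.prod_equiv σ _ _ fun r => by simp).symm

lemma rho_eq_sum {d N : ℕ} (x : GroupAlg d) : rho N d x = ∑ σ, x.coeff σ • permMat N d σ := by
  conv_lhs => rw [← sum_coeff_smul_basisPerm x, map_sum]
  simp only [map_smul, rho_basisPerm]

lemma tensorPow_mul_rho {d N : ℕ} (A : Matrix (Fin N) (Fin N) ℂ) (x : GroupAlg d) :
    tensorPow d A * rho N d x = rho N d x * tensorPow d A := by
  simp only [rho_eq_sum, Finset.mul_sum, Finset.sum_mul, mul_smul_comm, smul_mul_assoc,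
    tensorPow_mul_permMat]

lemma trace_tensorPow_mul_permMat {d N : ℕ} (A : Matrix (Fin N) (Fin N) ℂ)
    (σ : Equiv.Perm (Fin d)) :
    (tensorPow d A * permMat N d σ).trace = ∑ i : TIndex N d, ∏ r, A (i (σ r)) (i r) := by
  rw [tensorPow_mul_permMat, Matrix.trace]
  simp only [Matrix.diag_apply, permMat_mul_apply, tensorPow_apply, Function.comp_apply]

/-! ### The commutant of the unitary group on tensor space -/

lemma exists_perm_comp_eq_of_card_fiber_eq {d : ℕ} {κ : Type*} [DecidableEq κ] {u v : Fin d → κ}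
    (h : ∀ a, (Finset.univ.filter fun r => u r = a).card =
      (Finset.univ.filter fun r => v r = a).card) :
    ∃ σ : Equiv.Perm (Fin d), v ∘ σ = u := by
  have e : ∀ a, Nonempty ({r // u r = a} ≃ {r // v r = a}) := fun a =>
    ⟨Fintype.equivOfCardEq (by rw [Fintype.card_subtype, Fintype.card_subtype, h])⟩
  exact ⟨Equiv.ofFiberEquiv fun a => (e a).some, funext fun r => Equiv.ofFiberEquiv_map _ r⟩

/-- The exponent vector of the monomial `∏ r, X (u r)`. -/
def exponentOf {d : ℕ} {κ : Type*} (u : Fin d → κ) : κ →₀ ℕ := ∑ r, Finsupp.single (u r) 1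

lemma exists_perm_comp_eq_of_exponentOf_eq {d : ℕ} {κ : Type*} [DecidableEq κ] {u v : Fin d → κ}
    (h : exponentOf u = exponentOf v) : ∃ σ : Equiv.Perm (Fin d), v ∘ σ = u := by
  refine exists_perm_comp_eq_of_card_fiber_eq fun a => ?_
  have := DFunLike.congr_fun h a
  simpa [exponentOf, Finsupp.single_apply] using this

lemma prod_X_eq_monomial {d : ℕ} {κ : Type*} (u : Fin d → κ) :
    ∏ r, (MvPolynomial.X (u r) : MvPolynomial κ ℂ) = MvPolynomial.monomial (exponentOf u) 1 := by
  rw [exponentOf, MvPolynomial.monomial_sum_one]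
  rfl

/-- A function of index tuples that is invariant under permutations extends to a linear functional
on polynomials. -/
lemma exists_functional_of_invariant {d : ℕ} {κ : Type*} [DecidableEq κ] (f : (Fin d → κ) → ℂ)
    (hf : ∀ u (σ : Equiv.Perm (Fin d)), f (u ∘ σ) = f u) :
    ∃ φ : MvPolynomial κ ℂ →ₗ[ℂ] ℂ, ∀ u, φ (∏ r, MvPolynomial.X (u r)) = f u := by
  classical
  -- A monomial determines the tuple up to permutation, so invariance makes the choice of tuple
  -- irrelevant; monomials that arise from no tuple are sent to 0.
  refine ⟨(MvPolynomial.basisMonomials κ ℂ).constr ℂ fun m =>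
    if h : ∃ u : Fin d → κ, exponentOf u = m then f h.choose else 0, fun u => ?_⟩
  have h : ∃ v : Fin d → κ, exponentOf v = exponentOf u := ⟨u, rfl⟩
  rw [prod_X_eq_monomial, ← congrFun (MvPolynomial.coe_basisMonomials κ ℂ) (exponentOf u),
    Module.Basis.constr_basis, dif_pos h]
  obtain ⟨σ, hσ⟩ := exists_perm_comp_eq_of_exponentOf_eq h.choose_spec
  rw [← hσ, hf]

/-- Commuting with `g^{⊗d}` is a family of polynomial identities in the entries of `g`, which hold
formally once they hold on GL. An entry of `Z` is a permutation-invariant function of the index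
pairs, so a linear functional on polynomials replaces each monomial in the entries by the
corresponding entry of `Z`. -/
lemma comm_of_comm_gl {N d : ℕ} {Y : Matrix (TIndex N d) (TIndex N d) ℂ}
    (hY : ∀ g : Matrix (Fin N) (Fin N) ℂ, IsUnit g.det →
      Y * tensorPow d g = tensorPow d g * Y)
    {Z : Matrix (TIndex N d) (TIndex N d) ℂ}
    (hZ : ∀ σ, permMat N d σ * Z = Z * permMat N d σ) : Y * Z = Z * Y := by
  obtain ⟨φ, hφ⟩ := exists_functional_of_invariant
    (fun u : Fin d → Fin N × Fin N => Z (Prod.fst ∘ u) (Prod.snd ∘ u)) fun u σ => by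
      have h := congrFun (congrFun (hZ σ) (Prod.fst ∘ u)) (Prod.snd ∘ u ∘ σ)
      rw [permMat_mul_apply, mul_permMat_apply] at h
      have h2 : (Prod.snd ∘ u ∘ σ) ∘ ⇑σ⁻¹ = Prod.snd ∘ u := by
        ext x
        simp
      rw [h2] at h
      exact h
  ext i k
  let P : MvPolynomial (Fin N × Fin N) ℂ :=
    ∑ j : TIndex N d, Y i j • ∏ r, MvPolynomial.X (j r, k r)
  let Q : MvPolynomial (Fin N × Fin N) ℂ :=
    ∑ j : TIndex N d, Y j k • ∏ r, MvPolynomial.X (i r, j r)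
  have hPQ : P = Q := MvPolynomial.eq_of_eval_eq_on_gl fun g => by
    have h := congrFun (congrFun (hY g (by
      simpa using (Matrix.isUnit_iff_isUnit_det _).1 g.isUnit)) i) k
    simp only [Matrix.mul_apply, tensorPow_apply] at h
    simp only [P, Q, map_sum, MvPolynomial.smul_eval, map_prod, MvPolynomial.eval_X]
    rw [h]
    exact Finset.sum_congr rfl fun j _ => mul_comm _ _
  have h := congrArg φ hPQ
  simp only [P, Q, map_sum, map_smul, smul_eq_mul] at h
  rw [Matrix.mul_apply, Matrix.mul_apply]
  refine Eq.trans (Finset.sum_congr rfl fun j _ => ?_) (h.trans (Finset.sum_congr rfl fun j _ => ?_))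
  · rw [hφ fun r => (j r, k r)]
    rfl
  · rw [hφ fun r => (i r, j r), mul_comm]
    rfl

lemma tensorPow_diagonal {N d : ℕ} (x : Fin N → ℂ) :
    tensorPow d (Matrix.diagonal x) = Matrix.diagonal fun i => ∏ r, x (i r) := by
  ext i j
  rw [tensorPow_apply]
  by_cases h : i = j
  · subst h
    simp
  · obtain ⟨r, hr⟩ := Function.ne_iff.1 h
    rw [Matrix.diagonal_apply_ne _ h]
    exact Finset.prod_eq_zero (Finset.mem_univ r) (Matrix.diagonal_apply_ne _ hr)

lemma diagonal_mem_unitaryGroup {N : ℕ} {x : Fin N → ℂ} (hx : ∀ i, ‖x i‖ = 1) :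
    Matrix.diagonal x ∈ Matrix.unitaryGroup (Fin N) ℂ := by
  rw [Matrix.mem_unitaryGroup_iff, Matrix.star_eq_conjTranspose, Matrix.diagonal_conjTranspose,
    Matrix.diagonal_mul_diagonal, ← Matrix.diagonal_one]
  congr 1
  ext1 i
  rw [Pi.star_apply, RCLike.star_def, Complex.mul_conj, Complex.normSq_eq_norm_sq, hx]
  simp

/-- Commuting with diagonal unitary matrices forces a nonzero entry `Y i j` to join tuples with the
same content, and on such tuples every diagonal tensor power has equal eigenvalues. -/
lemma comm_diagonal_of_comm_unitary {N d : ℕ} {Y : Matrix (TIndex N d) (TIndex N d) ℂ}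
    (hY : ∀ U : UGroup N, Y * tensorPow d U = tensorPow d U * Y) (x : Fin N → ℂ) :
    Y * tensorPow d (Matrix.diagonal x) = tensorPow d (Matrix.diagonal x) * Y := by
  ext i j
  rw [tensorPow_diagonal, Matrix.mul_diagonal, Matrix.diagonal_mul]
  rcases eq_or_ne (Y i j) 0 with h0 | h0
  · rw [h0, zero_mul, mul_zero]
  have hcard : ∀ k, (Finset.univ.filter fun r => i r = k).card =
      (Finset.univ.filter fun r => j r = k).card := by
    intro k
    -- Multiplicities lie between 0 and `d`, so a root of unity of order `d + 1` distinguishes them.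
    have hζ := Complex.isPrimitiveRoot_exp (d + 1) d.succ_ne_zero
    set ζ := Complex.exp (2 * Real.pi * Complex.I / (d + 1 : ℕ))
    let u : Fin N → ℂ := fun l => if l = k then ζ else 1
    have hu : ∀ l, ‖u l‖ = 1 := fun l => by
      by_cases hl : l = k
      · simp only [u, if_pos hl, hζ.norm'_eq_one d.succ_ne_zero]
      · simp [u, if_neg hl]
    have h := congrFun (congrFun (hY ⟨_, diagonal_mem_unitaryGroup hu⟩) i) j
    rw [tensorPow_diagonal, Matrix.mul_diagonal, Matrix.diagonal_mul, mul_comm] at h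
    have h1 := mul_right_cancel₀ h0 h
    simp only [u, Finset.prod_ite, Finset.prod_const, one_pow, mul_one] at h1
    refine (hζ.pow_inj ?_ ?_ h1).symm <;>
      exact Nat.lt_succ_of_le ((Finset.card_le_univ _).trans_eq (Fintype.card_fin d))
  obtain ⟨σ, hσ⟩ := exists_perm_comp_eq_of_card_fiber_eq hcard
  rw [mul_comm, ← hσ]
  congr 1
  exact (Fintype.prod_equiv σ _ _ fun r => rfl).symm

open scoped ComplexOrder in
-- Diagonalize A*A by a unitary V and let s be the square roots of its positive eigenvalues; then
-- AVs⁻¹ is unitary. Thus unitary and diagonal matrices suffice to reach all of GL.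
lemma exists_singular_value_decomposition {N : ℕ} {A : Matrix (Fin N) (Fin N) ℂ}
    (hA : IsUnit A.det) : ∃ (W V : UGroup N) (x : Fin N → ℂ),
      A = (W : Matrix (Fin N) (Fin N) ℂ) * Matrix.diagonal x * (V : Matrix (Fin N) (Fin N) ℂ) := by
  have hpos : (A.conjTranspose * A).PosDef := Matrix.PosDef.conjTranspose_mul_self A
    (Matrix.mulVec_injective_iff_isUnit.2 ((Matrix.isUnit_iff_isUnit_det A).2 hA))
  set V := hpos.1.eigenvectorUnitary
  set y := hpos.1.eigenvalues with hy
  have hy0 : ∀ i, 0 < y i := hpos.eigenvalues_pos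
  have hV1 : (V : Matrix (Fin N) (Fin N) ℂ) * star (V : Matrix (Fin N) (Fin N) ℂ) = 1 :=
    Unitary.mul_star_self_of_mem V.2
  have hV2 : star (V : Matrix (Fin N) (Fin N) ℂ) * (V : Matrix (Fin N) (Fin N) ℂ) = 1 :=
    Unitary.star_mul_self_of_mem V.2
  have hspec := hpos.1.spectral_theorem
  rw [Unitary.conjStarAlgAut_apply] at hspec
  let s : Fin N → ℂ := fun i => (Real.sqrt (y i) : ℂ)
  have hs0 : ∀ i, s i ≠ 0 := fun i => by
    simpa [s] using (Real.sqrt_pos.2 (hy0 i)).ne'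
  have hD : Matrix.diagonal s⁻¹ * Matrix.diagonal s = 1 := by
    rw [Matrix.diagonal_mul_diagonal, ← Matrix.diagonal_one]
    congr 1
    ext1 i
    exact inv_mul_cancel₀ (hs0 i)
  let W : Matrix (Fin N) (Fin N) ℂ := A * V * Matrix.diagonal s⁻¹
  have hstar : star (Matrix.diagonal s⁻¹) = Matrix.diagonal s⁻¹ := by
    rw [Matrix.star_eq_conjTranspose, Matrix.diagonal_conjTranspose]
    congr 1
    ext1 i
    simp [s]
  have hW : W ∈ Matrix.unitaryGroup (Fin N) ℂ := by
    rw [Matrix.mem_unitaryGroup_iff']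
    have h1 : star W * W = Matrix.diagonal s⁻¹ * (star (V : Matrix (Fin N) (Fin N) ℂ) *
        (A.conjTranspose * A) * V) * Matrix.diagonal s⁻¹ := by
      simp only [W, star_mul, hstar, ← Matrix.star_eq_conjTranspose, mul_assoc]
    have h2 : star (V : Matrix (Fin N) (Fin N) ℂ) * (A.conjTranspose * A) * V =
        Matrix.diagonal s * Matrix.diagonal s := by
      rw [hspec, mul_assoc, mul_assoc, hV2, mul_one, ← mul_assoc, hV2, one_mul,
        Matrix.diagonal_mul_diagonal]
      congr 1
      ext1 i
      simp only [s, Function.comp_apply]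
      rw [← Complex.ofReal_mul, Real.mul_self_sqrt (hy0 i).le]
      rfl
    rw [h1, h2, ← mul_assoc, hD, one_mul, Matrix.diagonal_mul_diagonal, ← Matrix.diagonal_one]
    congr 1
    ext1 i
    exact mul_inv_cancel₀ (hs0 i)
  refine ⟨⟨W, hW⟩, V⁻¹, s, ?_⟩
  change A = A * V * Matrix.diagonal s⁻¹ * Matrix.diagonal s *
    star (V : Matrix (Fin N) (Fin N) ℂ)
  rw [mul_assoc (A * _), hD, mul_one, mul_assoc, hV1, mul_one]

lemma comm_gl_of_comm_unitary {N d : ℕ} {Y : Matrix (TIndex N d) (TIndex N d) ℂ}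
    (hY : ∀ U : UGroup N, Y * tensorPow d U = tensorPow d U * Y)
    (g : Matrix (Fin N) (Fin N) ℂ) (hg : IsUnit g.det) :
    Y * tensorPow d g = tensorPow d g * Y := by
  obtain ⟨W, V, x, rfl⟩ := exists_singular_value_decomposition hg
  rw [tensorPow_mul, tensorPow_mul, ← mul_assoc, ← mul_assoc, hY, mul_assoc (tensorPow d _) Y,
    comm_diagonal_of_comm_unitary hY, mul_assoc, mul_assoc, mul_assoc, hY]
  simp only [mul_assoc]

/-- Double commutant theorem for the group algebra of `S(d)` on tensor space. -/
lemma exists_rho_eq_of_comm_commutant {N d : ℕ} {Y : Matrix (TIndex N d) (TIndex N d) ℂ}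
    (hY : ∀ Z, (∀ σ, permMat N d σ * Z = Z * permMat N d σ) → Y * Z = Z * Y) :
    ∃ x, Y = rho N d x := by
  let S : Submodule ℂ (Matrix (TIndex N d) (TIndex N d) ℂ) :=
    LinearMap.range (rho N d).toLinearMap
  have hS : ∀ x, rho N d x ∈ S := fun x => ⟨x, rfl⟩
  obtain ⟨π₀, hπ₀⟩ := LinearMap.exists_extend (LinearMap.id : S →ₗ[ℂ] S)
  have hfix : ∀ s (hs : s ∈ S), (π₀ s : Matrix (TIndex N d) (TIndex N d) ℂ) = s := fun s hs =>
    congrArg Subtype.val (DFunLike.congr_fun hπ₀ ⟨s, hs⟩)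
  have hmul : ∀ σ, ∀ s ∈ S, permMat N d σ * s ∈ S := by
    rintro σ _ ⟨x, rfl⟩
    rw [← rho_basisPerm]
    exact ⟨basisPerm σ * x, map_mul (rho N d) _ _⟩
  -- Maschke averaging: any linear projection onto the image of the group algebra becomes
  -- equivariant for left multiplication by permutations, while keeping its image and fixing 1.
  let π : Matrix (TIndex N d) (TIndex N d) ℂ →ₗ[ℂ] Matrix (TIndex N d) (TIndex N d) ℂ :=
    (d.factorial : ℂ)⁻¹ • ∑ σ : Equiv.Perm (Fin d), LinearMap.mulLeft ℂ (permMat N d σ) ∘ₗ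
      S.subtype ∘ₗ π₀ ∘ₗ LinearMap.mulLeft ℂ (permMat N d σ⁻¹)
  have hπ : ∀ X, π X = (d.factorial : ℂ)⁻¹ • ∑ σ : Equiv.Perm (Fin d),
      permMat N d σ * (π₀ (permMat N d σ⁻¹ * X)).1 := fun X => by
    simp [π, LinearMap.sum_apply]
  have hπS : ∀ X, π X ∈ S := fun X => by
    rw [hπ]
    exact S.smul_mem _ (S.sum_mem fun σ _ => hmul σ _ (π₀ _).2)
  have hπ1 : π 1 = 1 := by
    have h : ∀ σ : Equiv.Perm (Fin d),
        permMat N d σ * (π₀ (permMat N d σ⁻¹ * 1)).1 = 1 := fun σ => by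
      rw [mul_one, hfix _ (by rw [← rho_basisPerm]; exact hS _), ← map_mul, mul_inv_cancel,
        map_one]
    rw [hπ]
    simp only [h, Finset.sum_const, Finset.card_univ, Fintype.card_perm, Fintype.card_fin]
    rw [← Nat.cast_smul_eq_nsmul ℂ, inv_smul_smul₀ (Nat.cast_ne_zero.2 d.factorial_ne_zero)]
  have hπτ : ∀ τ X, π (permMat N d τ * X) = permMat N d τ * π X := fun τ X => by
    rw [hπ, hπ, mul_smul_comm, Finset.mul_sum]
    congr 1
    refine Fintype.sum_equiv (Equiv.mulLeft τ⁻¹) _ _ fun σ => ?_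
    rw [Equiv.coe_mulLeft, ← mul_assoc, ← mul_assoc, ← map_mul, ← map_mul, mul_inv_rev, inv_inv,
      mul_inv_cancel_left]
  -- In coordinates, `π` is built from left multiplications by the matrices `Z l l'`, and
  -- equivariance of `π` says that these commute with the permutations.
  let Z : TIndex N d → TIndex N d → Matrix (TIndex N d) (TIndex N d) ℂ :=
    fun l l' => Matrix.of fun i k => π (Matrix.single k l 1) i l'
  have hZ : ∀ X i l', π X i l' = ∑ l, (Z l l' * X) i l := fun X i l' => by
    conv_lhs => rw [Matrix.matrix_eq_sum_single X]
    have h1 : ∀ k l, Matrix.single k l (X k l) = X k l • Matrix.single k l (1 : ℂ) :=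
      fun k l => by simp
    simp only [h1, map_sum, map_smul, Matrix.sum_apply, Matrix.smul_apply, smul_eq_mul,
      Matrix.mul_apply, Z, Matrix.of_apply]
    rw [Finset.sum_comm]
    exact Finset.sum_congr rfl fun l _ => Finset.sum_congr rfl fun k _ => mul_comm _ _
  have hZcomm : ∀ l l' τ, permMat N d τ * Z l l' = Z l l' * permMat N d τ := fun l l' τ => by
    ext i k
    have h := congrFun (congrFun (hπτ τ (Matrix.single k l 1)) i) l'
    rw [permMat_mul_apply] at h
    rw [permMat_mul_apply]
    refine Eq.trans h.symm ?_
    rw [hZ, Finset.sum_eq_single l]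
    · rw [← mul_assoc, Matrix.mul_single_apply_same, mul_one]
    · intro b _ hb
      rw [← mul_assoc, Matrix.mul_single_apply_of_ne _ _ _ _ _ hb]
    · simp
  -- As `Y` commutes with every `Z l l'`, it can be pulled out of `π`: π(Y) = Yπ(1) = Y. So `Y` lies
  -- in the image.
  have hfinal : π Y = Y := by
    ext i l'
    have hc : ∀ l, Z l l' * Y = Y * Z l l' := fun l => (hY _ (hZcomm l l')).symm
    rw [hZ]
    simp only [hc]
    simp only [Matrix.mul_apply]
    rw [Finset.sum_comm]
    have h1 : ∀ m, ∑ l, Y i m * Z l l' m l = Y i m * (1 : Matrix _ _ ℂ) m l' := fun m => by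
      rw [← Finset.mul_sum, ← hπ1, hZ]
      simp only [mul_one]
    simp only [h1]
    rw [← Matrix.mul_apply, mul_one]
  obtain ⟨x, hx⟩ := hπS Y
  exact ⟨x, by rw [← hfinal, ← hx]; rfl⟩

/-- Schur-Weyl duality: the commutant of the unitary group on tensor space is spanned by the
permutations of tensor factors. -/
theorem exists_rho_eq_of_comm_unitary {N d : ℕ} {Y : Matrix (TIndex N d) (TIndex N d) ℂ}
    (hY : ∀ U : UGroup N, Y * tensorPow d U = tensorPow d U * Y) : ∃ x, Y = rho N d x :=
  exists_rho_eq_of_comm_commutant fun _ hZ => comm_of_comm_gl (comm_gl_of_comm_unitary hY) hZ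

/-! ### Power sums as traces on tensor space -/

open scoped Classical in
-- Orbits inside the support correspond to the cycle factors of `σ`, and the remaining orbits are
-- fixed points, which contribute the parts equal to 1.
lemma prod_cycles_eq_prod_parts {d : ℕ} {M : Type*} [CommMonoid M] (σ : Equiv.Perm (Fin d))
    (g : ℕ → M) :
    ∏ q : Quotient (Equiv.Perm.SameCycle.setoid σ),
      g (Finset.univ.filter fun r => Quotient.mk _ r = q).card = (σ.partition.parts.map g).prod := by
  let s := Equiv.Perm.SameCycle.setoid σ
  have hmk : ∀ x y : Fin d, (Quotient.mk s x = Quotient.mk s y) ↔ σ.SameCycle x y := fun x y =>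
    Quotient.eq (r := s)
  let P : Quotient s → Prop := fun q => ∃ x ∈ σ.support, Quotient.mk s x = q
  have hsupp : ∀ x ∈ σ.support,
      (Finset.univ.filter fun r => Quotient.mk s r = Quotient.mk s x) =
        (σ.cycleOf x).support := fun x hx => by
    ext r
    rw [Finset.mem_filter, hmk, Equiv.Perm.mem_support_cycleOf_iff]
    simp only [Finset.mem_univ, true_and, hx, and_true]
    exact Equiv.Perm.sameCycle_comm
  have hfix : ∀ x ∉ σ.support,
      (Finset.univ.filter fun r => Quotient.mk s r = Quotient.mk s x) = {x} := fun x hx => by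
    ext r
    rw [Finset.mem_filter, hmk, Finset.mem_singleton]
    simp only [Finset.mem_univ, true_and]
    constructor
    · intro h
      rw [Equiv.Perm.notMem_support] at hx
      exact (h.symm.eq_of_left hx).symm
    · rintro rfl
      exact Equiv.Perm.SameCycle.refl _ _
  rw [← Finset.prod_filter_mul_prod_filter_not Finset.univ P, Equiv.Perm.parts_partition,
    Multiset.map_add, Multiset.prod_add]
  congr 1
  · rw [Equiv.Perm.cycleType_def, Multiset.map_map]
    change _ = ∏ c ∈ σ.cycleFactorsFinset, g c.support.card
    let cyc : Quotient s → Equiv.Perm (Fin d) :=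
      Quotient.lift (fun x => σ.cycleOf x) fun x y h => Equiv.Perm.SameCycle.cycleOf_eq h
    refine Finset.prod_nbij cyc ?_ ?_ ?_ ?_
    · intro q hq
      obtain ⟨x, hx, rfl⟩ := (Finset.mem_filter.1 hq).2
      exact Equiv.Perm.cycleOf_mem_cycleFactorsFinset_iff.2 hx
    · intro q hq q' hq' h
      obtain ⟨x, hx, rfl⟩ := (Finset.mem_filter.1 hq).2
      obtain ⟨y, hy, rfl⟩ := (Finset.mem_filter.1 hq').2
      have h' : σ.cycleOf x = σ.cycleOf y := h
      have hxy : y ∈ (σ.cycleOf x).support := by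
        rw [h']
        exact Equiv.Perm.mem_support_cycleOf_iff.2 ⟨Equiv.Perm.SameCycle.refl _ _, hy⟩
      exact (hmk x y).2 (Equiv.Perm.mem_support_cycleOf_iff.1 hxy).1
    · intro c hc
      obtain ⟨x, hx⟩ := (Equiv.Perm.mem_cycleFactorsFinset_iff.1 hc).1.nonempty_support
      refine ⟨Quotient.mk s x, ?_, (Equiv.Perm.cycle_is_cycleOf hx hc).symm⟩
      exact Finset.mem_filter.2 ⟨Finset.mem_univ _, x,
        Equiv.Perm.mem_cycleFactorsFinset_support_le hc hx, rfl⟩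
    · intro q hq
      obtain ⟨x, hx, rfl⟩ := (Finset.mem_filter.1 hq).2
      rw [hsupp x hx]
      rfl
  · have h : ∏ x ∈ σ.supportᶜ, g 1 = ∏ q with ¬ P q,
        g (Finset.univ.filter fun r => Quotient.mk s r = q).card := by
      refine Finset.prod_nbij (Quotient.mk s) ?_ ?_ ?_ ?_
      · intro x hx
        refine Finset.mem_filter.2 ⟨Finset.mem_univ _, ?_⟩
        rintro ⟨y, hy, hyx⟩
        have hyx' : y ∈ Finset.univ.filter fun r => Quotient.mk s r = Quotient.mk s x :=
          Finset.mem_filter.2 ⟨Finset.mem_univ _, hyx⟩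
        rw [hfix x (Finset.mem_compl.1 hx), Finset.mem_singleton] at hyx'
        exact Finset.mem_compl.1 hx (hyx' ▸ hy)
      · intro x hx y hy hxy
        have hyx' : x ∈ Finset.univ.filter fun r => Quotient.mk s r = Quotient.mk s y :=
          Finset.mem_filter.2 ⟨Finset.mem_univ _, hxy⟩
        rwa [hfix y (Finset.mem_compl.1 hy), Finset.mem_singleton] at hyx'
      · intro q hq
        obtain ⟨x, rfl⟩ := Quotient.exists_rep q
        exact ⟨x, Finset.mem_compl.2 fun hx => (Finset.mem_filter.1 hq).2 ⟨x, hx, rfl⟩, rfl⟩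
      · intro x hx
        rw [hfix x (Finset.mem_compl.1 hx), Finset.card_singleton]
    rw [← h, Finset.prod_const, Finset.card_compl, Multiset.map_replicate, Multiset.prod_replicate]

open scoped Classical in
-- A coloring fixed by `σ` is a free choice of color on each cycle; expanding the product of power
-- sums over the cycles enumerates these choices.
lemma sum_fixed_colorings {d N : ℕ} (σ : Equiv.Perm (Fin d)) (x : Fin N → ℂ) :
    ∑ i : TIndex N d with i ∘ σ = i, ∏ r, x (i r) =
      (σ.partition.parts.map fun k => ∑ j, x j ^ k).prod := by
  let s := Equiv.Perm.SameCycle.setoid σ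
  rw [← prod_cycles_eq_prod_parts σ fun k => ∑ j, x j ^ k, Finset.prod_univ_sum,
    Fintype.piFinset_univ]
  symm
  refine Finset.sum_nbij (fun h r => h (Quotient.mk s r)) ?_ ?_ ?_ ?_
  · intro h _
    refine Finset.mem_filter.2 ⟨Finset.mem_univ _, funext fun r => congrArg h ?_⟩
    exact Quotient.sound (s := s) (Equiv.Perm.sameCycle_apply_left.2 (.refl _ _))
  · intro h _ h' _ hh
    ext1 q
    obtain ⟨r, rfl⟩ := Quotient.exists_rep q
    exact congrFun hh r
  · intro i hi
    have hi' : i ∘ σ = i := (Finset.mem_filter.1 hi).2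
    have hpow : ∀ (n : ℕ) r, i ((σ ^ n) r) = i r := by
      intro n
      induction n with
      | zero => exact fun r => rfl
      | succ n ih =>
        intro r
        rw [pow_succ, Equiv.Perm.mul_apply, ih]
        exact congrFun hi' r
    refine ⟨Quotient.lift i fun a b hab => ?_, Finset.mem_coe.2 (Finset.mem_univ _), rfl⟩
    obtain ⟨n, hn⟩ := Equiv.Perm.SameCycle.exists_nat_pow_eq hab
    rw [← hn, hpow]
  · intro h _
    rw [← Finset.prod_fiberwise Finset.univ (fun r => Quotient.mk s r) fun r =>
      x (h (Quotient.mk s r))]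
    refine Finset.prod_congr rfl fun q _ => ?_
    rw [← Finset.prod_const]
    refine Finset.prod_congr rfl fun r hr => ?_
    rw [(Finset.mem_filter.1 hr).2]

lemma powerSum_eq {N d : ℕ} (α : d.Partition) (x : Fin N → ℂ) :
    powerSum α x = (α.parts.map fun k => ∑ j, x j ^ k).prod := by
  rw [powerSum, MvPolynomial.psumPart, map_multiset_prod, Multiset.map_map]
  congr 2
  ext k
  simp [MvPolynomial.psum]

/-- A nonzero product requires `i r ≤ i (σ r)` for all `r`. Both sides have the same sum over `r`,
so all these inequalities are equalities. -/
lemma sum_prod_of_lowerTriangular {d N : ℕ} {M : Matrix (Fin N) (Fin N) ℂ}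
    (hM : ∀ i j, i < j → M i j = 0) (σ : Equiv.Perm (Fin d)) :
    ∑ i : TIndex N d, ∏ r, M (i (σ r)) (i r) =
      ∑ i : TIndex N d with i ∘ σ = i, ∏ r, M (i r) (i r) := by
  rw [Finset.sum_filter]
  refine Finset.sum_congr rfl fun i _ => ?_
  split_ifs with h
  · exact Finset.prod_congr rfl fun r _ => by rw [show i (σ r) = i r from congrFun h r]
  · by_contra h0
    apply h
    have hle : ∀ r ∈ Finset.univ, (i r : ℕ) ≤ i (σ r) := fun r hr => by
      by_contra hlt
      exact h0 (Finset.prod_eq_zero hr (hM _ _ (not_le.1 hlt)))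
    have heq := (Finset.sum_eq_sum_iff_of_le hle).1 (Equiv.sum_comp σ fun r => (i r : ℕ)).symm
    exact funext fun r => Fin.ext (heq r (Finset.mem_univ r)).symm

/-- Every endomorphism of a finite-dimensional complex vector space is triangular in some basis. -/
lemma exists_triangular_basis (n : ℕ) : ∀ {V : Type} [AddCommGroup V] [Module ℂ V]
    [FiniteDimensional ℂ V] (_ : Module.finrank ℂ V = n) (f : Module.End ℂ V),
    ∃ b : Module.Basis (Fin n) ℂ V, ∀ i j, i < j → b.repr (f (b j)) i = 0 := by
  induction n with
  | zero =>
    intro V _ _ _ hn f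
    exact ⟨Module.finBasisOfFinrankEq ℂ V hn, fun i => i.elim0⟩
  | succ n ih =>
    intro V _ _ _ hn f
    have : Nontrivial V := Module.nontrivial_of_finrank_pos (R := ℂ) (by omega)
    obtain ⟨μ, hμ⟩ := Module.End.exists_eigenvalue f
    set g : Module.End ℂ V := f - algebraMap ℂ (Module.End ℂ V) μ with hg
    have hlt : LinearMap.range g < ⊤ := by
      rw [lt_top_iff_ne_top, Ne, ← LinearMap.isUnit_iff_range_eq_top,
        LinearMap.isUnit_iff_ker_eq_bot]
      rw [Module.End.hasEigenvalue_iff, Module.End.eigenspace_def] at hμ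
      exact hμ
    -- The range of `f - μ` lies in a hyperplane, which is therefore invariant under `f`; the
    -- induction applies to it.
    obtain ⟨φ, hφ, hker⟩ := Submodule.exists_le_ker_of_lt_top _ hlt
    have hf : ∀ v, φ (f v) = μ * φ v := fun v => by
      have : φ (g v) = 0 := hker ⟨v, rfl⟩
      simpa [hg, sub_eq_zero] using this
    obtain ⟨y, hy⟩ : ∃ y, φ y ≠ 0 := by
      by_contra! h
      exact hφ (LinearMap.ext h)
    have hinv : ∀ v ∈ LinearMap.ker φ, f v ∈ LinearMap.ker φ := fun v hv => by
      rw [LinearMap.mem_ker] at hv ⊢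
      rw [hf, hv, mul_zero]
    have hrank := Module.Dual.finrank_ker_add_one_of_ne_zero hφ
    obtain ⟨b, hb⟩ := ih (V := LinearMap.ker φ) (by omega) (f.restrict hinv)
    -- The vector outside the hyperplane comes first: images of the later basis vectors have no
    -- component along it.
    let B := Module.Basis.mkFinCons y b
      (fun c x hx h => by
        have h1 := congrArg φ h
        rw [map_add, map_smul, LinearMap.mem_ker.1 hx, add_zero, map_zero, smul_eq_mul] at h1
        exact (mul_eq_zero.1 h1).resolve_right hy)
      (fun z => ⟨-(φ z / φ y), by
        rw [LinearMap.mem_ker, map_add, map_smul, smul_eq_mul, neg_mul, div_mul_cancel₀ _ hy,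
          add_neg_cancel]⟩)
    have hBs : ∀ k, B k.succ = b k := fun k => by
      simp [B, Module.Basis.coe_mkFinCons]
    have hrepr : ∀ v : LinearMap.ker φ, B.repr v = (b.repr v).mapDomain Fin.succ := by
      have : B.repr.toLinearMap ∘ₗ (LinearMap.ker φ).subtype =
          Finsupp.lmapDomain ℂ ℂ Fin.succ ∘ₗ b.repr.toLinearMap := by
        refine b.ext fun k => ?_
        simp only [LinearMap.comp_apply, Submodule.subtype_apply, LinearEquiv.coe_coe, ← hBs,
          Module.Basis.repr_self, Finsupp.lmapDomain_apply, Finsupp.mapDomain_single]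
      exact fun v => DFunLike.congr_fun this v
    refine ⟨B, fun i j hij => ?_⟩
    obtain ⟨k, rfl⟩ := Fin.exists_succ_eq.2 (Fin.ne_zero_of_lt hij)
    have hfb : B.repr (f (B k.succ)) = (b.repr (f.restrict hinv (b k))).mapDomain Fin.succ := by
      rw [← hrepr, hBs]
      rfl
    rw [hfb]
    induction i using Fin.cases with
    | zero =>
      rw [Finsupp.mapDomain_of_notMem_range]
      rintro ⟨m, hm⟩
      exact Fin.succ_ne_zero m hm
    | succ m =>
      rw [Finsupp.mapDomain_apply (Fin.succ_injective n)]
      exact hb m k (Fin.succ_lt_succ_iff.1 hij)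

/-- The trace of a tensor power times a permutation is a power sum of the eigenvalues. -/
theorem trace_tensorPow_mul_permMat_eq_powerSum {d N : ℕ} {A : Matrix (Fin N) (Fin N) ℂ}
    {a : Fin N → ℂ} (ha : IsEigenvalueList A a) {α : d.Partition} {σ : Equiv.Perm (Fin d)}
    (hσ : σ ∈ conjClass α) : (tensorPow d A * permMat N d σ).trace = powerSum α a := by
  obtain ⟨b, hb⟩ := exists_triangular_basis N (by simp) (Matrix.toLin' A)
  set M := LinearMap.toMatrix b b (Matrix.toLin' A) with hMdef
  have hM : ∀ i j, i < j → M i j = 0 := fun i j hij => by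
    rw [hMdef, LinearMap.toMatrix_apply, hb i j hij]
  set e := Pi.basisFun ℂ (Fin N)
  have hA : e.toMatrix b * M * b.toMatrix e = A := by
    rw [hMdef, basis_toMatrix_mul_linearMap_toMatrix_mul_basis_toMatrix,
      LinearMap.toMatrix_eq_toMatrix', LinearMap.toMatrix'_toLin']
  have htr : (tensorPow d A * permMat N d σ).trace = (tensorPow d M * permMat N d σ).trace := by
    rw [← hA, tensorPow_mul, tensorPow_mul, mul_assoc, mul_assoc, Matrix.trace_mul_comm,
      tensorPow_mul_permMat, mul_assoc, mul_assoc, ← tensorPow_mul,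
      Module.Basis.toMatrix_mul_toMatrix_flip, tensorPow_one, mul_one]
  -- Equality of characteristic polynomials identifies the diagonal of `M` with the list `a` as
  -- multisets, which is all that power sums see. `M` is lower triangular, hence the transpose.
  have hchar : ∏ i, (Polynomial.X - Polynomial.C (a i)) =
      ∏ i, (Polynomial.X - Polynomial.C (M i i)) := by
    rw [← ha, ← Matrix.charpoly_toLin', ← LinearMap.charpoly_toMatrix _ b, ← hMdef,
      ← Matrix.charpoly_transpose, Matrix.charpoly_of_isUpperTriangular]
    · simp
    · exact fun i j hij => hM j i hij
  have hroots : Finset.univ.val.map a = Finset.univ.val.map fun i => M i i := by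
    have h := congrArg Polynomial.roots hchar
    have h2 : ∀ x : Fin N → ℂ, (∏ i, (Polynomial.X - Polynomial.C (x i))).roots =
        Finset.univ.val.map x := fun x => by
      rw [← Polynomial.roots_multiset_prod_X_sub_C (Finset.univ.val.map x), Multiset.map_map]
      rfl
    rwa [h2, h2] at h
  have hsum : ∀ k : ℕ, ∑ j, a j ^ k = ∑ j, M j j ^ k := fun k => by
    have h := congrArg (fun m : Multiset ℂ => (m.map (· ^ k)).sum) hroots
    simp only [Multiset.map_map] at h
    exact h
  rw [htr, trace_tensorPow_mul_permMat, sum_prod_of_lowerTriangular hM,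
    sum_fixed_colorings σ fun j => M j j, powerSum_eq, mem_conjClass.1 hσ]
  simp only [hsum]

/-! ### Averages over the unitary group -/

/-- The equivariant map `X ↦ ∑ σ, Tr (X σ⁻¹) σ` from matrices to the image of the group algebra. -/
def permTransform {N d : ℕ} (X : Matrix (TIndex N d) (TIndex N d) ℂ) :
    Matrix (TIndex N d) (TIndex N d) ℂ :=
  ∑ σ, (X * permMat N d σ⁻¹).trace • permMat N d σ

/-- The character of tensor space, as an element of the group algebra. -/
def tensorCharacter (N d : ℕ) : GroupAlg d :=
  ∑ σ, (permMat N d σ⁻¹).trace • basisPerm σ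

lemma permTransform_one {N d : ℕ} :
    permTransform (1 : Matrix (TIndex N d) (TIndex N d) ℂ) = rho N d (tensorCharacter N d) := by
  simp only [permTransform, tensorCharacter, one_mul, map_sum, map_smul, rho_basisPerm]

lemma permTransform_permMat {N d : ℕ} (τ : Equiv.Perm (Fin d)) :
    permTransform (permMat N d τ) = rho N d (tensorCharacter N d) * permMat N d τ := by
  rw [← permTransform_one, permTransform, permTransform, Finset.sum_mul]
  refine Fintype.sum_equiv (Equiv.mulRight τ⁻¹) _ _ fun σ => ?_
  rw [Equiv.coe_mulRight, one_mul, smul_mul_assoc, ← map_mul, ← map_mul, inv_mul_cancel_right,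
    mul_inv_rev, inv_inv]

lemma permTransform_rho {N d : ℕ} (x : GroupAlg d) :
    permTransform (rho N d x) = rho N d (tensorCharacter N d) * rho N d x := by
  have h : permTransform (rho N d x) = ∑ τ, x.coeff τ • permTransform (permMat N d τ) := by
    simp only [permTransform, rho_eq_sum x, Finset.sum_mul, Matrix.trace_sum, Finset.sum_smul,
      Finset.smul_sum, smul_mul_assoc, Matrix.trace_smul, smul_assoc]
    exact Finset.sum_comm
  rw [h, rho_eq_sum x, Finset.mul_sum]
  simp only [permTransform_permMat, mul_smul_comm]

lemma tensorCharacter_comm {N d : ℕ} (x : GroupAlg d) :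
    x * tensorCharacter N d = tensorCharacter N d * x := by
  have h : ∀ g : Equiv.Perm (Fin d),
      basisPerm g * tensorCharacter N d = tensorCharacter N d * basisPerm g := by
    intro g
    rw [tensorCharacter, Finset.mul_sum, Finset.sum_mul]
    refine Fintype.sum_equiv (MulAut.conj g).toEquiv _ _ fun σ => ?_
    have ht : (permMat N d ((MulAut.conj g) σ)⁻¹).trace = (permMat N d σ⁻¹).trace := by
      rw [MulAut.conj_apply, mul_inv_rev, mul_inv_rev, inv_inv, map_mul, Matrix.trace_mul_comm,
        ← map_mul, mul_assoc, inv_mul_cancel, mul_one]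
    change _ = ((permMat N d ((MulAut.conj g) σ)⁻¹).trace • basisPerm (MulAut.conj g σ)) *
      basisPerm g
    rw [ht, mul_smul_comm, smul_mul_assoc, basisPerm_mul, basisPerm_mul, MulAut.conj_apply,
      inv_mul_cancel_right]
  rw [← sum_coeff_smul_basisPerm x, Finset.mul_sum, Finset.sum_mul]
  simp only [smul_mul_assoc, mul_smul_comm, h]

/-- Up to the factor `youngScalar`, this sum of characters against traces is the trace of the
central idempotent on tensor space, known to be dim V · dim W. -/
lemma traceV_tensorCharacter {N d : ℕ} (lam : d.Partition) :
    traceV lam (tensorCharacter N d) = d.factorial * dimW N lam := by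
  have h := trace_rho_centralIdem N lam
  rw [rho_eq_sum, Matrix.trace_sum] at h
  simp only [Matrix.trace_smul, smul_eq_mul, coeff_centralIdem] at h
  have h2 : traceV lam (tensorCharacter N d) =
      ∑ σ, (permMat N d σ).trace * character lam σ⁻¹ := by
    rw [tensorCharacter, map_sum]
    refine Fintype.sum_equiv (Equiv.inv _) _ _ fun σ => ?_
    rw [map_smul, smul_eq_mul, Equiv.inv_apply, inv_inv, character_eq_traceV]
  rw [h2, ← youngScalar_mul_dimV lam, mul_assoc, ← h, Finset.mul_sum]
  refine Finset.sum_congr rfl fun σ _ => ?_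
  field_simp [youngScalar_ne_zero lam]

lemma tensorCharacter_eq {N d : ℕ} : tensorCharacter N d =
    ∑ lam, ((d.factorial : ℂ) * dimW N lam / dimV lam) • centralIdem lam := by
  conv_lhs => rw [eq_sum_smul_centralIdem (tensorCharacter_comm (N := N) (d := d))]
  simp only [traceV_tensorCharacter]

lemma sum_smul_centralIdem_mul {d : ℕ} (s t : d.Partition → ℂ) :
    (∑ lam, s lam • centralIdem lam) * ∑ lam, t lam • centralIdem lam =
      ∑ lam, (s lam * t lam) • centralIdem lam := by
  rw [Finset.sum_mul]
  refine Finset.sum_congr rfl fun lam _ => ?_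
  rw [Finset.mul_sum, Finset.sum_eq_single lam]
  · rw [smul_mul_smul_comm, centralIdem_mul_self]
  · intro mu _ hmu
    rw [smul_mul_smul_comm, centralIdem_mul_of_ne hmu.symm, smul_zero]
  · simp

/-- The Weingarten element: the inverse of the tensor character on the blocks that act
nontrivially on tensor space. -/
def weingarten (N d : ℕ) : GroupAlg d :=
  ∑ lam : d.Partition, ((dimV lam : ℂ) / (d.factorial * dimW N lam)) • centralIdem lam

lemma weingarten_comm {N d : ℕ} (x : GroupAlg d) :
    x * weingarten N d = weingarten N d * x := by
  simp only [weingarten, Finset.mul_sum, Finset.sum_mul, mul_smul_comm, smul_mul_assoc,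
    centralIdem_comm]

lemma rho_weingarten_mul_tensorCharacter {N d : ℕ} :
    rho N d (weingarten N d) * rho N d (tensorCharacter N d) = 1 := by
  rw [← map_mul, tensorCharacter_eq, weingarten, sum_smul_centralIdem_mul,
    ← map_one (rho N d), ← sum_centralIdem, map_sum, map_sum]
  refine Finset.sum_congr rfl fun lam _ => ?_
  -- When `dimW` vanishes, the Weingarten coefficient is 0 by the convention for division, and the
  -- idempotent itself acts as 0, so nothing is lost.
  by_cases h : dimW N lam = 0
  · rw [map_smul, rho_centralIdem_eq_zero h, smul_zero]
  · have h1 : (dimW N lam : ℂ) ≠ 0 := Nat.cast_ne_zero.2 h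
    have h2 : (d.factorial : ℂ) ≠ 0 := Nat.cast_ne_zero.2 d.factorial_ne_zero
    have h3 := dimV_ne_zero lam
    rw [show (dimV lam : ℂ) / (d.factorial * dimW N lam) *
      ((d.factorial : ℂ) * dimW N lam / dimV lam) = 1 by field_simp, one_smul]

lemma rho_eq_weingarten_mul_permTransform {N d : ℕ} (x : GroupAlg d) :
    rho N d x = rho N d (weingarten N d) * permTransform (rho N d x) := by
  rw [permTransform_rho, ← mul_assoc, rho_weingarten_mul_tensorCharacter, one_mul]

/-! ### Haar averaging on tensor space. -/

instance isProbabilityMeasure_haarU (N : ℕ) : IsProbabilityMeasure (haarU N) :=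
  ⟨Measure.haarMeasure_self⟩

instance isHaarMeasure_haarU (N : ℕ) : (haarU N).IsHaarMeasure := by
  unfold haarU
  infer_instance

lemma integrable_haarU_of_continuous {N : ℕ} {f : UGroup N → ℂ} (hf : Continuous f) :
    Integrable f (haarU N) :=
  hf.integrable_of_hasCompactSupport (HasCompactSupport.of_compactSpace f)

lemma continuous_tensorPow {N d : ℕ} :
    Continuous (tensorPow d : Matrix (Fin N) (Fin N) ℂ → _) := by
  refine continuous_matrix fun i j => ?_
  simp only [tensorPow_apply]
  fun_prop

lemma continuous_coe_inv {N : ℕ} :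
    Continuous fun U : UGroup N => ((U⁻¹ : UGroup N) : Matrix (Fin N) (Fin N) ℂ) :=
  continuous_subtype_val.comp continuous_inv

/-- The conjugate of a matrix on tensor space by a tensor power of a unitary matrix. -/
def unitaryConj {N d : ℕ} (X : Matrix (TIndex N d) (TIndex N d) ℂ) (U : UGroup N) :
    Matrix (TIndex N d) (TIndex N d) ℂ :=
  tensorPow d (U : Matrix (Fin N) (Fin N) ℂ) * X *
    tensorPow d ((U⁻¹ : UGroup N) : Matrix (Fin N) (Fin N) ℂ)

lemma continuous_unitaryConj {N d : ℕ} (X : Matrix (TIndex N d) (TIndex N d) ℂ) :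
    Continuous (unitaryConj X) :=
  ((continuous_tensorPow.comp continuous_subtype_val).mul continuous_const).mul
    (continuous_tensorPow.comp continuous_coe_inv)

lemma tensorPow_inv_mul {N d : ℕ} (U : UGroup N) :
    tensorPow d ((U⁻¹ : UGroup N) : Matrix (Fin N) (Fin N) ℂ) *
      tensorPow d (U : Matrix (Fin N) (Fin N) ℂ) = 1 := by
  rw [← tensorPow_mul, ← Submonoid.coe_mul, inv_mul_cancel, Submonoid.coe_one, tensorPow_one]

/-- The average of the conjugates of `X` over the unitary group. -/
def unitaryAverage {N d : ℕ} (X : Matrix (TIndex N d) (TIndex N d) ℂ) :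
    Matrix (TIndex N d) (TIndex N d) ℂ :=
  Matrix.of fun i j => ∫ U, unitaryConj X U i j ∂haarU N

/-- The average is defined entrywise, so a functional is expanded over matrix units before it is
moved under the integral. -/
lemma linearMap_unitaryAverage {N d : ℕ} (X : Matrix (TIndex N d) (TIndex N d) ℂ)
    (ℓ : Matrix (TIndex N d) (TIndex N d) ℂ →ₗ[ℂ] ℂ) :
    ℓ (unitaryAverage X) = ∫ U, ℓ (unitaryConj X U) ∂haarU N := by
  have h : ∀ M, ℓ M = ∑ i, ∑ j, M i j * ℓ (Matrix.single i j 1) := fun M => by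
    conv_lhs => rw [Matrix.matrix_eq_sum_single M]
    have h1 : ∀ k l, Matrix.single k l (M k l) = M k l • Matrix.single k l (1 : ℂ) :=
      fun k l => by simp
    simp only [h1, map_sum, map_smul, smul_eq_mul]
  have hint : ∀ i j, Integrable (fun U => unitaryConj X U i j * ℓ (Matrix.single i j 1))
      (haarU N) := fun i j =>
    integrable_haarU_of_continuous (((continuous_unitaryConj X).matrix_elem i j).mul
      continuous_const)
  simp only [h (unitaryAverage X), h (unitaryConj X _)]
  rw [integral_finsetSum _ fun i _ => integrable_finsetSum _ fun j _ => hint i j]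
  refine Finset.sum_congr rfl fun i _ => ?_
  rw [integral_finsetSum _ fun j _ => hint i j]
  refine Finset.sum_congr rfl fun j _ => ?_
  rw [integral_mul_const]
  rfl

lemma unitaryAverage_comm {N d : ℕ} (X : Matrix (TIndex N d) (TIndex N d) ℂ) (V : UGroup N) :
    unitaryAverage X * tensorPow d V = tensorPow d V * unitaryAverage X := by
  have h : tensorPow d V * unitaryAverage X *
      tensorPow d ((V⁻¹ : UGroup N) : Matrix (Fin N) (Fin N) ℂ) = unitaryAverage X := by
    ext i j
    let ℓ : Matrix (TIndex N d) (TIndex N d) ℂ →ₗ[ℂ] ℂ := Matrix.entryLinearMap ℂ ℂ i j ∘ₗ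
      LinearMap.mulRight ℂ (tensorPow d ((V⁻¹ : UGroup N) : Matrix (Fin N) (Fin N) ℂ)) ∘ₗ
      LinearMap.mulLeft ℂ (tensorPow d (V : Matrix (Fin N) (Fin N) ℂ))
    have hℓ : ∀ M, ℓ M = (tensorPow d (V : Matrix (Fin N) (Fin N) ℂ) * M *
      tensorPow d ((V⁻¹ : UGroup N) : Matrix (Fin N) (Fin N) ℂ)) i j := fun _ => rfl
    rw [← hℓ, linearMap_unitaryAverage]
    -- Conjugating by `V` replaces `U` by `V * U`, which left invariance of Haar measure undoes.
    have hV : ∀ U, ℓ (unitaryConj X U) = unitaryConj X (V * U) i j := fun U => by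
      rw [hℓ, unitaryConj, unitaryConj, mul_inv_rev, Submonoid.coe_mul, Submonoid.coe_mul,
        tensorPow_mul, tensorPow_mul]
      simp only [mul_assoc]
    simp only [hV]
    exact integral_mul_left_eq_self (fun U => unitaryConj X U i j) V
  conv_lhs => rw [← h]
  rw [mul_assoc, tensorPow_inv_mul, mul_one]

/-- The Weingarten formula. -/
theorem unitaryAverage_eq {N d : ℕ} (X : Matrix (TIndex N d) (TIndex N d) ℂ) :
    unitaryAverage X = rho N d (weingarten N d) * permTransform X := by
  obtain ⟨x, hx⟩ := exists_rho_eq_of_comm_unitary (unitaryAverage_comm X)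
  -- The traces defining `permTransform` do not change under conjugation by a tensor power, since
  -- permutations commute with it.
  have h : permTransform (unitaryAverage X) = permTransform X := by
    refine Finset.sum_congr rfl fun σ _ => ?_
    congr 1
    let ℓ : Matrix (TIndex N d) (TIndex N d) ℂ →ₗ[ℂ] ℂ := Matrix.traceLinearMap _ ℂ ℂ ∘ₗ
      LinearMap.mulRight ℂ (permMat N d σ⁻¹)
    have hℓ : ∀ M, ℓ M = (M * permMat N d σ⁻¹).trace := fun _ => rfl
    rw [← hℓ, ← hℓ, linearMap_unitaryAverage]
    have hU : ∀ U, ℓ (unitaryConj X U) = ℓ X := fun U => by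
      rw [hℓ, hℓ, unitaryConj, mul_assoc, tensorPow_mul_permMat, mul_assoc, Matrix.trace_mul_comm,
        mul_assoc, mul_assoc, tensorPow_inv_mul, mul_one]
    simp [hU]
  rw [← h, hx]
  exact rho_eq_weingarten_mul_permTransform x

/-! ### Moments -/

lemma trace_tensorPow_mul_rho_centralIdem {d N : ℕ} {A : Matrix (Fin N) (Fin N) ℂ}
    {a : Fin N → ℂ} (ha : IsEigenvalueList A a) (lam : d.Partition) :
    (tensorPow d A * rho N d (centralIdem lam)).trace =
      (dimV lam : ℂ) ^ 2 / d.factorial * ∑ α, powerSum α a * omega α lam := by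
  rw [rho_eq_sum, Finset.mul_sum, Matrix.trace_sum, sum_perm_eq_sum_conjClass, Finset.mul_sum]
  refine Finset.sum_congr rfl fun α _ => ?_
  rw [mul_left_comm, ← sum_conjClass_coeff_centralIdem, Finset.mul_sum]
  refine Finset.sum_congr rfl fun σ hσ => ?_
  rw [mul_smul_comm, Matrix.trace_smul, trace_tensorPow_mul_permMat_eq_powerSum ha hσ,
    smul_eq_mul, mul_comm]

lemma permTransform_tensorPow {d N : ℕ} {B : Matrix (Fin N) (Fin N) ℂ}
    {b : Fin N → ℂ} (hb : IsEigenvalueList B b) :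
    permTransform (tensorPow d B) = rho N d (∑ β, powerSum β b • classSum β) := by
  rw [permTransform, sum_perm_eq_sum_conjClass, map_sum]
  refine Finset.sum_congr rfl fun β _ => ?_
  rw [map_smul, classSum, map_sum, Finset.smul_sum]
  refine Finset.sum_congr rfl fun σ hσ => ?_
  rw [trace_tensorPow_mul_permMat_eq_powerSum hb (inv_mem_conjClass.2 hσ), rho_basisPerm]

/-- Moments of `Tr (A U B U⁻¹)`. -/
theorem integral_trace_conj_pow {N : ℕ} (d : ℕ) {A B : Matrix (Fin N) (Fin N) ℂ}
    {a b : Fin N → ℂ} (ha : IsEigenvalueList A a) (hb : IsEigenvalueList B b) :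
    ∫ U : UGroup N, Matrix.trace (A * (U : Matrix (Fin N) (Fin N) ℂ) * B *
        ((U⁻¹ : UGroup N) : Matrix (Fin N) (Fin N) ℂ)) ^ d ∂haarU N =
      ∑ α : d.Partition, ∑ β : d.Partition, powerSum α a * powerSum β b *
        ∑ lam : d.Partition, (dimV lam : ℂ) ^ 3 / ((d.factorial : ℂ) ^ 2 * dimW N lam) *
          (omega α lam * omega β lam) := by
  let ℓ : Matrix (TIndex N d) (TIndex N d) ℂ →ₗ[ℂ] ℂ := Matrix.traceLinearMap _ ℂ ℂ ∘ₗ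
    LinearMap.mulLeft ℂ (tensorPow d A)
  have hℓ : ∀ M, ℓ M = (tensorPow d A * M).trace := fun _ => rfl
  have h1 : ∀ U : UGroup N, Matrix.trace (A * (U : Matrix (Fin N) (Fin N) ℂ) * B *
        ((U⁻¹ : UGroup N) : Matrix (Fin N) (Fin N) ℂ)) ^ d =
      ℓ (unitaryConj (tensorPow d B) U) := fun U => by
    rw [← trace_tensorPow, hℓ, unitaryConj]
    simp only [tensorPow_mul, mul_assoc]
  simp only [h1]
  rw [← linearMap_unitaryAverage, unitaryAverage_eq, permTransform_tensorPow hb, ← map_mul]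
  have h2 : ∑ β : d.Partition, powerSum β b • classSum β =
      ∑ lam, (∑ β : d.Partition, powerSum β b * omega β lam) • centralIdem lam := by
    simp only [classSum_eq, Finset.smul_sum, smul_smul, Finset.sum_smul]
    exact Finset.sum_comm
  rw [h2, weingarten, sum_smul_centralIdem_mul, hℓ, map_sum, Finset.mul_sum, Matrix.trace_sum]
  simp only [map_smul, mul_smul_comm, Matrix.trace_smul,
    trace_tensorPow_mul_rho_centralIdem ha, smul_eq_mul]
  simp only [Finset.mul_sum, Finset.sum_mul]
  rw [Finset.sum_comm]
  refine Finset.sum_congr rfl fun α _ => ?_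
  rw [Finset.sum_comm]
  refine Finset.sum_congr rfl fun β _ => Finset.sum_congr rfl fun lam _ => ?_
  ring

lemma sum_trace_single_mul_single {ι : Type*} [Fintype ι] [DecidableEq ι] (P Q : Matrix ι ι ℂ) :
    ∑ i, ∑ j, (Q * (Matrix.single j i 1 * P * Matrix.single i j 1)).trace =
      P.trace * Q.trace := by
  simp only [Matrix.single_mul_mul_single, one_mul, mul_one, Matrix.trace_mul_single]
  simp only [Matrix.trace, Matrix.diag_apply, Finset.sum_mul_sum]
  simp [mul_comm]

/-- With `sum_trace_single_mul_single`, this is the contraction used for mixed moments: one splits a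
product of traces into terms linear in conjugates of matrix units, the other reassembles a single
trace after averaging. -/
lemma sum_trace_mul_single_mul_trace {ι : Type*} [Fintype ι] [DecidableEq ι] (X Y : Matrix ι ι ℂ) :
    ∑ i, ∑ j, (Matrix.single i j 1 * X).trace * (Matrix.single j i 1 * Y).trace =
      (X * Y).trace := by
  simp only [Matrix.trace_single_mul]
  simp only [Matrix.trace, Matrix.diag_apply, Matrix.mul_apply]
  rw [Finset.sum_comm]
  simp

/-- Mixed moments of `Tr (A U)` and `Tr (B U⁻¹)`. -/
theorem integral_trace_pow_mul_trace_inv_pow {N : ℕ} (d : ℕ) {A B : Matrix (Fin N) (Fin N) ℂ}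
    {c : Fin N → ℂ} (hc : IsEigenvalueList (A * B) c) :
    ∫ U : UGroup N, Matrix.trace (A * (U : Matrix (Fin N) (Fin N) ℂ)) ^ d *
        Matrix.trace (B * ((U⁻¹ : UGroup N) : Matrix (Fin N) (Fin N) ℂ)) ^ d ∂haarU N =
      ∑ β : d.Partition, powerSum β c *
        ∑ lam : d.Partition, (dimV lam : ℂ) ^ 3 / ((d.factorial : ℂ) * dimW N lam) *
          omega β lam := by
  let ℓ : TIndex N d → TIndex N d → Matrix (TIndex N d) (TIndex N d) ℂ →ₗ[ℂ] ℂ := fun i j =>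
    Matrix.traceLinearMap _ ℂ ℂ ∘ₗ
      LinearMap.mulLeft ℂ (tensorPow d B * Matrix.single j i 1 * tensorPow d A)
  have hℓ : ∀ i j M, ℓ i j M =
      (tensorPow d B * Matrix.single j i 1 * tensorPow d A * M).trace := fun _ _ _ => rfl
  have h1 : ∀ U : UGroup N, Matrix.trace (A * (U : Matrix (Fin N) (Fin N) ℂ)) ^ d *
        Matrix.trace (B * ((U⁻¹ : UGroup N) : Matrix (Fin N) (Fin N) ℂ)) ^ d =
      ∑ i, ∑ j, ℓ i j (unitaryConj (Matrix.single i j 1) U) := fun U => by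
    rw [Matrix.trace_mul_comm B, ← trace_tensorPow, ← trace_tensorPow,
      ← sum_trace_single_mul_single]
    refine Finset.sum_congr rfl fun i _ => Finset.sum_congr rfl fun j _ => ?_
    rw [hℓ, unitaryConj, tensorPow_mul, tensorPow_mul, mul_assoc (tensorPow d _) (tensorPow d B),
      Matrix.trace_mul_comm]
    simp only [mul_assoc]
  have hint : ∀ i j, Integrable (fun U => ℓ i j (unitaryConj (Matrix.single i j 1) U))
      (haarU N) := fun i j => integrable_haarU_of_continuous
    ((continuous_const.mul (continuous_unitaryConj _)).matrix_trace)
  simp only [h1]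
  rw [integral_finsetSum _ fun i _ => integrable_finsetSum _ fun j _ => hint i j]
  simp_rw [integral_finsetSum _ fun j _ => hint _ j, ← linearMap_unitaryAverage,
    unitaryAverage_eq]
  have h2 : ∀ i j, ℓ i j (rho N d (weingarten N d) * permTransform (Matrix.single i j 1)) =
      ∑ σ, (Matrix.single i j 1 * permMat N d σ⁻¹).trace * (Matrix.single j i 1 *
        (tensorPow d A * rho N d (weingarten N d) * permMat N d σ * tensorPow d B)).trace :=
    fun i j => by
      rw [permTransform, Finset.mul_sum, map_sum]
      refine Finset.sum_congr rfl fun σ _ => ?_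
      rw [mul_smul_comm, map_smul, smul_eq_mul, hℓ, mul_assoc (tensorPow d B), mul_assoc (tensorPow d B),
        Matrix.trace_mul_comm (tensorPow d B)]
      simp only [mul_assoc]
  -- The permutation passes through the tensor power of `A` and the central Weingarten element and
  -- cancels with its inverse, so all d! summands agree and only the product AB survives.
  have h3 : ∀ σ, (permMat N d σ⁻¹ * (tensorPow d A * rho N d (weingarten N d) * permMat N d σ *
      tensorPow d B)).trace = (tensorPow d (A * B) * rho N d (weingarten N d)).trace := fun σ => by
    have hw : rho N d (weingarten N d) * permMat N d σ =
        permMat N d σ * rho N d (weingarten N d) := by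
      rw [← rho_basisPerm, ← map_mul, ← map_mul, weingarten_comm]
    rw [mul_assoc (tensorPow d A), hw, ← mul_assoc (tensorPow d A), tensorPow_mul_permMat,
      mul_assoc, mul_assoc, ← mul_assoc, ← map_mul, inv_mul_cancel, map_one, one_mul,
      ← tensorPow_mul_rho, ← mul_assoc, ← tensorPow_mul]
  have h4 : ∑ i, ∑ j, ∑ σ, (Matrix.single i j 1 * permMat N d σ⁻¹).trace * (Matrix.single j i 1 *
        (tensorPow d A * rho N d (weingarten N d) * permMat N d σ * tensorPow d B)).trace =
      d.factorial * (tensorPow d (A * B) * rho N d (weingarten N d)).trace := by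
    have : ∀ i, ∑ j, ∑ σ, (Matrix.single i j 1 * permMat N d σ⁻¹).trace * (Matrix.single j i 1 *
        (tensorPow d A * rho N d (weingarten N d) * permMat N d σ * tensorPow d B)).trace =
        ∑ σ, ∑ j, (Matrix.single i j 1 * permMat N d σ⁻¹).trace * (Matrix.single j i 1 *
        (tensorPow d A * rho N d (weingarten N d) * permMat N d σ * tensorPow d B)).trace :=
      fun i => Finset.sum_comm
    simp only [this]
    rw [Finset.sum_comm]
    simp only [sum_trace_mul_single_mul_trace, h3, Finset.sum_const, Finset.card_univ,
      Fintype.card_perm, Fintype.card_fin, nsmul_eq_mul]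
  simp only [h2]
  rw [h4, weingarten, map_sum, Finset.mul_sum, Matrix.trace_sum]
  simp only [map_smul, mul_smul_comm, Matrix.trace_smul,
    trace_tensorPow_mul_rho_centralIdem hc, smul_eq_mul, Finset.mul_sum]
  rw [Finset.sum_comm]
  refine Finset.sum_congr rfl fun β _ => Finset.sum_congr rfl fun lam _ => ?_
  have hd : (d.factorial : ℂ) ≠ 0 := Nat.cast_ne_zero.2 d.factorial_ne_zero
  by_cases hW : (dimW N lam : ℂ) = 0
  · simp [hW]
  · field_simp

/-! ### The terms of the string expansions -/

lemma lis_revPerm_le_one (d : ℕ) : lis (Fin.revPerm : Equiv.Perm (Fin d)) ≤ 1 := by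
  refine Finset.sup_le fun s hs => ?_
  have hmono := (Finset.mem_filter.1 hs).2
  refine Finset.card_le_one.2 fun x hx y hy => ?_
  by_contra hxy
  rcases lt_or_gt_of_ne hxy with h | h
  · exact lt_asymm h (Fin.rev_lt_rev.1 (hmono hx hy h))
  · exact lt_asymm h (Fin.rev_lt_rev.1 (hmono hy hx h))

/-- The reversal has no increasing subsequence of length 2. -/
lemma card_lisPerms_ne_zero {N : ℕ} (hN : 0 < N) (d : ℕ) : ((lisPerms N d).card : ℂ) ≠ 0 := by
  refine Nat.cast_ne_zero.2 (Finset.card_ne_zero_of_mem (a := Fin.revPerm) ?_)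
  exact Finset.mem_filter.2 ⟨Finset.mem_univ _, (lis_revPerm_le_one d).trans hN⟩

lemma Omega_inv {N d : ℕ} (lam : d.Partition) :
    (Omega N lam)⁻¹ = (N : ℂ) ^ d / d.factorial * (dimV lam / dimW N lam) := by
  rw [Omega, mul_inv, inv_div, inv_div]

/-- Here |S_N(d)| cancels, leaving (dim V)²/d! times the inverse of Ω. The row restriction can then
be dropped, since the extra diagrams have `dimW = 0` and a quotient by 0 is 0. -/
lemma probLIS_mul_plancherel {N : ℕ} (hN : 0 < N) {d : ℕ} (f : d.Partition → ℂ) :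
    (probLIS N d : ℂ) * plancherel N d (fun lam => f lam * (Omega N lam)⁻¹) =
      (N : ℂ) ^ d * ∑ lam, (dimV lam : ℂ) ^ 3 / ((d.factorial : ℂ) ^ 2 * dimW N lam) * f lam := by
  have hL := card_lisPerms_ne_zero hN d
  have hd : (d.factorial : ℂ) ≠ 0 := Nat.cast_ne_zero.2 d.factorial_ne_zero
  rw [plancherel, Finset.sum_filter, Finset.mul_sum, Finset.mul_sum]
  refine Finset.sum_congr rfl fun lam _ => ?_
  split_ifs with h
  · rw [Omega_inv, probLIS, Complex.ofReal_div, Complex.ofReal_natCast, Complex.ofReal_natCast]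
    by_cases hW : (dimW N lam : ℂ) = 0
    · simp [hW]
    · field_simp
  · rw [dimW_eq_zero (not_le.1 h)]
    simp

theorem hcizTerm_eq {N : ℕ} (hN : 0 < N) (d : ℕ) (z : ℂ) {A B : Matrix (Fin N) (Fin N) ℂ}
    {a b : Fin N → ℂ} (ha : IsEigenvalueList A a) (hb : IsEigenvalueList B b) :
    hcizTerm N d (z, a, b) = (z * N) ^ d / d.factorial *
      ∫ U : UGroup N, Matrix.trace (A * (U : Matrix (Fin N) (Fin N) ℂ) * B *
        ((U⁻¹ : UGroup N) : Matrix (Fin N) (Fin N) ℂ)) ^ d ∂haarU N := by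
  rw [integral_trace_conj_pow d ha hb, hcizTerm, mul_assoc, mul_pow, mul_div_right_comm, mul_assoc]
  congr 1
  rw [Finset.mul_sum, Finset.mul_sum]
  refine Finset.sum_congr rfl fun α _ => ?_
  rw [Finset.mul_sum, Finset.mul_sum]
  refine Finset.sum_congr rfl fun β _ => ?_
  have h := probLIS_mul_plancherel hN fun lam : d.Partition => omega α lam * omega β lam
  have h2 : (fun lam => omega α lam * (Omega N lam)⁻¹ * omega β lam) =
      fun lam => omega α lam * omega β lam * (Omega N lam)⁻¹ := funext fun lam => by ring
  rw [h2, mul_left_comm, h, mul_left_comm]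

theorem bgwTerm_eq {N : ℕ} (hN : 0 < N) (d : ℕ) (z : ℂ) {A B : Matrix (Fin N) (Fin N) ℂ}
    {c : Fin N → ℂ} (hc : IsEigenvalueList (A * B) c) :
    bgwTerm N d (z, c) = (z * N) ^ (2 * d) / (d.factorial : ℂ) ^ 2 *
      ∫ U : UGroup N, Matrix.trace (A * (U : Matrix (Fin N) (Fin N) ℂ)) ^ d *
        Matrix.trace (B * ((U⁻¹ : UGroup N) : Matrix (Fin N) (Fin N) ℂ)) ^ d ∂haarU N := by
  have hd : (d.factorial : ℂ) ≠ 0 := Nat.cast_ne_zero.2 d.factorial_ne_zero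
  rw [integral_trace_pow_mul_trace_inv_pow d hc, bgwTerm, mul_assoc, Finset.mul_sum,
    Finset.mul_sum, Finset.mul_sum]
  refine Finset.sum_congr rfl fun β _ => ?_
  have h := probLIS_mul_plancherel hN fun lam : d.Partition => omega β lam
  have h2 : (fun lam => (Omega N lam)⁻¹ * omega β lam) =
      fun lam => omega β lam * (Omega N lam)⁻¹ := funext fun lam => mul_comm _ _
  rw [h2, mul_left_comm (probLIS N d : ℂ), h]
  have h3 : ∑ lam : d.Partition, (dimV lam : ℂ) ^ 3 / ((d.factorial : ℂ) ^ 2 * dimW N lam) *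
      omega β lam = (d.factorial : ℂ)⁻¹ * ∑ lam : d.Partition,
        (dimV lam : ℂ) ^ 3 / ((d.factorial : ℂ) * dimW N lam) * omega β lam := by
    rw [Finset.mul_sum]
    refine Finset.sum_congr rfl fun lam _ => ?_
    by_cases hW : (dimW N lam : ℂ) = 0
    · simp [hW]
    · field_simp
  rw [h3, mul_pow, two_mul, pow_add (N : ℂ)]
  field_simp

/-! ### Integration of exponential series -/

lemma hasSum_integral_haarU {N : ℕ} {ι : Type*} [Countable ι] {F : ι → UGroup N → ℂ}
    (hF : ∀ i, Continuous (F i)) {u : ι → ℝ} (hu : Summable u) (hb : ∀ i U, ‖F i U‖ ≤ u i)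
    {G : UGroup N → ℂ} (hG : ∀ U, HasSum (fun i => F i U) (G U)) :
    HasSum (fun i => ∫ U, F i U ∂haarU N) (∫ U, G U ∂haarU N) :=
  hasSum_integral_of_dominated_convergence (fun i _ => u i)
    (fun i => (integrable_haarU_of_continuous (hF i)).aestronglyMeasurable)
    (fun i => Eventually.of_forall (hb i)) (Eventually.of_forall fun _ => hu)
    (integrable_const _) (Eventually.of_forall hG)

lemma exists_bound_of_continuous {N : ℕ} {T : UGroup N → ℂ} (hT : Continuous T) :
    ∃ C : ℝ, 0 ≤ C ∧ ∀ U, ‖T U‖ ≤ C := by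
  obtain ⟨C, hC⟩ := (isCompact_range hT).isBounded.exists_norm_le
  exact ⟨C, (norm_nonneg _).trans (hC _ ⟨1, rfl⟩), fun U => hC _ ⟨U, rfl⟩⟩

lemma hasSum_complex_exp (x : ℂ) : HasSum (fun n : ℕ => x ^ n / n.factorial) (Complex.exp x) := by
  rw [Complex.exp_eq_exp_ℂ]
  exact NormedSpace.expSeries_div_hasSum_exp x

lemma hasSum_complex_mul {f g : ℕ → ℂ} {s t : ℂ} (hf : HasSum f s) (hg : HasSum g t) :
    HasSum (fun p : ℕ × ℕ => f p.1 * g p.2) (s * t) :=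
  hf.mul hg (summable_mul_of_summable_norm hf.summable.norm hg.summable.norm)

lemma hasSum_complex_exp_add (x y : ℂ) :
    HasSum (fun p : ℕ × ℕ => x ^ p.1 / p.1.factorial * (y ^ p.2 / p.2.factorial))
      (Complex.exp (x + y)) := by
  have h := hasSum_complex_mul (hasSum_complex_exp x) (hasSum_complex_exp y)
  rw [← Complex.exp_add] at h
  exact h

lemma norm_pow_div_factorial_le {x : ℂ} {C : ℝ} (h : ‖x‖ ≤ C) (n : ℕ) :
    ‖x ^ n / n.factorial‖ ≤ C ^ n / n.factorial := by
  rw [norm_div, norm_pow, Complex.norm_natCast]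
  gcongr

lemma hasSum_integral_exp {N : ℕ} {T : UGroup N → ℂ} (hT : Continuous T) :
    HasSum (fun d : ℕ => ∫ U, T U ^ d / d.factorial ∂haarU N)
      (∫ U, Complex.exp (T U) ∂haarU N) := by
  obtain ⟨C, -, hC⟩ := exists_bound_of_continuous hT
  exact hasSum_integral_haarU (fun d => by fun_prop) (Real.summable_pow_div_factorial C)
    (fun d U => norm_pow_div_factorial_le (hC U) d) fun U => hasSum_complex_exp _

lemma hasSum_integral_exp_add {N : ℕ} {S T : UGroup N → ℂ} (hS : Continuous S)
    (hT : Continuous T) :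
    HasSum (fun p : ℕ × ℕ => ∫ U, S U ^ p.1 / p.1.factorial * (T U ^ p.2 / p.2.factorial) ∂haarU N)
      (∫ U, Complex.exp (S U + T U) ∂haarU N) := by
  obtain ⟨C, hC0, hC⟩ := exists_bound_of_continuous hS
  obtain ⟨C', hC0', hC'⟩ := exists_bound_of_continuous hT
  refine hasSum_integral_haarU (fun d => by fun_prop)
    ((Real.summable_pow_div_factorial C).mul_of_nonneg (Real.summable_pow_div_factorial C')
      (fun n => by positivity) (fun n => by positivity)) (fun p U => ?_) fun U => ?_
  · rw [norm_mul]
    exact mul_le_mul (norm_pow_div_factorial_le (hC U) _) (norm_pow_div_factorial_le (hC' U) _)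
      (norm_nonneg _) (by positivity)
  · exact hasSum_complex_exp_add (S U) (T U)

lemma continuous_trace_conj {N : ℕ} (A B : Matrix (Fin N) (Fin N) ℂ) :
    Continuous fun U : UGroup N => Matrix.trace (A * (U : Matrix (Fin N) (Fin N) ℂ) * B *
      ((U⁻¹ : UGroup N) : Matrix (Fin N) (Fin N) ℂ)) :=
  (((continuous_const.mul continuous_subtype_val).mul continuous_const).mul
    continuous_coe_inv).matrix_trace

lemma continuous_trace_mul {N : ℕ} (A : Matrix (Fin N) (Fin N) ℂ) :
    Continuous fun U : UGroup N => Matrix.trace (A * (U : Matrix (Fin N) (Fin N) ℂ)) :=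
  (continuous_const.mul continuous_subtype_val).matrix_trace

lemma continuous_trace_mul_inv {N : ℕ} (B : Matrix (Fin N) (Fin N) ℂ) :
    Continuous fun U : UGroup N =>
      Matrix.trace (B * ((U⁻¹ : UGroup N) : Matrix (Fin N) (Fin N) ℂ)) :=
  (continuous_const.mul continuous_coe_inv).matrix_trace

/-- Unequal moments of `Tr (A U)` and `Tr (B U⁻¹)` vanish, by invariance under scalars. -/
lemma integral_trace_pow_mul_trace_inv_pow_of_ne {N : ℕ} (A B : Matrix (Fin N) (Fin N) ℂ)
    {m k : ℕ} (h : m ≠ k) :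
    ∫ U : UGroup N, Matrix.trace (A * (U : Matrix (Fin N) (Fin N) ℂ)) ^ m *
        Matrix.trace (B * ((U⁻¹ : UGroup N) : Matrix (Fin N) (Fin N) ℂ)) ^ k ∂haarU N = 0 := by
  -- Translation by the scalar `ζ` multiplies the integrand by `ζ^(m-k)`; the order `m + k + 1`
  -- exceeds both exponents, so this factor is not 1.
  have hζ := Complex.isPrimitiveRoot_exp (m + k + 1) (m + k).succ_ne_zero
  set ζ := Complex.exp (2 * Real.pi * Complex.I / (m + k + 1 : ℕ))
  have hnorm : ‖ζ‖ = 1 := hζ.norm'_eq_one (m + k).succ_ne_zero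
  have hζ0 : ζ ≠ 0 := norm_ne_zero_iff.1 (by rw [hnorm]; exact one_ne_zero)
  let V : UGroup N := ⟨Matrix.diagonal fun _ => ζ, diagonal_mem_unitaryGroup fun _ => hnorm⟩
  have hV : (V : Matrix (Fin N) (Fin N) ℂ) = ζ • 1 := by
    rw [← Matrix.diagonal_one, ← Matrix.diagonal_smul]
    simp [V, Pi.smul_def]
  have hVinv : ((V⁻¹ : UGroup N) : Matrix (Fin N) (Fin N) ℂ) = ζ⁻¹ • 1 := by
    have h1 : (V : Matrix (Fin N) (Fin N) ℂ) * ((V⁻¹ : UGroup N) : Matrix (Fin N) (Fin N) ℂ) = 1 := by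
      rw [← Submonoid.coe_mul, mul_inv_cancel, Submonoid.coe_one]
    rw [hV, smul_mul_assoc, one_mul] at h1
    rw [← h1, inv_smul_smul₀ hζ0]
  set f : UGroup N → ℂ := fun U => Matrix.trace (A * (U : Matrix (Fin N) (Fin N) ℂ)) ^ m *
    Matrix.trace (B * ((U⁻¹ : UGroup N) : Matrix (Fin N) (Fin N) ℂ)) ^ k with hf
  have hinv : ∀ U, f (V * U) = ζ ^ m * (ζ⁻¹) ^ k * f U := fun U => by
    simp only [hf, mul_inv_rev, Submonoid.coe_mul, hV, hVinv, smul_mul_assoc, one_mul,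
      mul_smul_comm, mul_one, Matrix.trace_smul, smul_eq_mul, mul_pow]
    ring
  have h1 := integral_mul_left_eq_self (μ := haarU N) f V
  simp only [hinv] at h1
  rw [integral_const_mul] at h1
  by_contra h0
  have h2 : ζ ^ m * (ζ⁻¹) ^ k = 1 := mul_right_cancel₀ h0 (by rw [h1, one_mul])
  rw [inv_pow, ← div_eq_mul_inv, div_eq_one_iff_eq (pow_ne_zero _ hζ0)] at h2
  exact h (hζ.pow_inj (by omega) (by omega) h2)

theorem hasSum_hciz {N : ℕ} (hN : 0 < N) (z : ℂ) {A B : Matrix (Fin N) (Fin N) ℂ}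
    {a b : Fin N → ℂ} (ha : IsEigenvalueList A a) (hb : IsEigenvalueList B b) :
    HasSum (fun d => hcizTerm N d (z, a, b)) (hciz N z A B) := by
  have h := hasSum_integral_exp (T := fun U : UGroup N => z * N * Matrix.trace
    (A * (U : Matrix (Fin N) (Fin N) ℂ) * B * ((U⁻¹ : UGroup N) : Matrix (Fin N) (Fin N) ℂ)))
    (continuous_const.mul (continuous_trace_conj A B))
  refine h.congr_fun fun d => ?_
  rw [hcizTerm_eq hN d z ha hb, ← integral_const_mul]
  simp only [mul_pow]
  congr 1
  ext1 U
  ring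

theorem hasSum_bgw {N : ℕ} (hN : 0 < N) (z : ℂ) {A B : Matrix (Fin N) (Fin N) ℂ}
    {c : Fin N → ℂ} (hc : IsEigenvalueList (A * B) c) :
    HasSum (fun d => bgwTerm N d (z, c)) (bgw N z A B) := by
  have h := hasSum_integral_exp_add
    (S := fun U : UGroup N => z * N * Matrix.trace (A * (U : Matrix (Fin N) (Fin N) ℂ)))
    (T := fun U : UGroup N => z * N *
      Matrix.trace (B * ((U⁻¹ : UGroup N) : Matrix (Fin N) (Fin N) ℂ)))
    (continuous_const.mul (continuous_trace_mul A))
    (continuous_const.mul (continuous_trace_mul_inv B))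
  have hterm : ∀ m k : ℕ, ∫ U : UGroup N,
      (z * N * Matrix.trace (A * (U : Matrix (Fin N) (Fin N) ℂ))) ^ m / m.factorial *
        ((z * N * Matrix.trace (B * ((U⁻¹ : UGroup N) : Matrix (Fin N) (Fin N) ℂ))) ^ k /
          k.factorial) ∂haarU N =
      (z * N) ^ (m + k) / (m.factorial * k.factorial) *
        ∫ U : UGroup N, Matrix.trace (A * (U : Matrix (Fin N) (Fin N) ℂ)) ^ m *
          Matrix.trace (B * ((U⁻¹ : UGroup N) : Matrix (Fin N) (Fin N) ℂ)) ^ k ∂haarU N := by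
    intro m k
    rw [← integral_const_mul]
    congr 1
    ext1 U
    rw [mul_pow, mul_pow, pow_add]
    ring
  simp only [hterm, ← mul_add, ← Matrix.trace_add] at h
  -- The double series is supported on the diagonal, so it can be summed over `d` alone.
  have hinj : Function.Injective fun d : ℕ => (d, d) := fun m n hmn => (Prod.ext_iff.1 hmn).1
  rw [← hinj.hasSum_iff] at h
  · refine h.congr_fun fun d => ?_
    rw [bgwTerm_eq hN d z hc, Function.comp_apply, ← two_mul, ← pow_two]
  · rintro ⟨m, k⟩ hmk
    have hne : m ≠ k := fun e => hmk ⟨m, by rw [e]⟩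
    rw [integral_trace_pow_mul_trace_inv_pow_of_ne A B hne, mul_zero]

/-! ### Convergence -/

lemma convergesAbsUnifOnCompacts_of_bound {X : Type*} [TopologicalSpace X] {f : ℕ → X → ℂ}
    (h : ∀ K : Set X, IsCompact K → ∃ C : ℝ, ∀ d, ∀ x ∈ K, ‖f d x‖ ≤ C ^ d / d.factorial) :
    ConvergesAbsUnifOnCompacts f := by
  have hsum : ∀ C : ℝ, Summable fun d : ℕ => C ^ (d + 1) / (d + 1).factorial := fun C =>
    (summable_nat_add_iff 1).2 (Real.summable_pow_div_factorial C)
  refine ⟨fun x => ?_, fun K hK => ?_⟩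
  · obtain ⟨C, hC⟩ := h {x} isCompact_singleton
    exact (hsum C).of_nonneg_of_le (fun _ => norm_nonneg _) fun d => hC (d + 1) x rfl
  · obtain ⟨C, hC⟩ := h K hK
    exact ⟨tendstoUniformlyOn_tsum_nat (hsum C) fun d x hx => by
        rw [norm_norm]
        exact hC (d + 1) x hx,
      tendstoUniformlyOn_tsum_nat (hsum C) fun d x hx => hC (d + 1) x hx⟩

lemma isEigenvalueList_diagonal {N : ℕ} (a : Fin N → ℂ) :
    IsEigenvalueList (Matrix.diagonal a) a :=
  Matrix.charpoly_diagonal a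

lemma norm_integral_haarU_le {N : ℕ} {f : UGroup N → ℂ} {C : ℝ} (h : ∀ U, ‖f U‖ ≤ C) :
    ‖∫ U, f U ∂haarU N‖ ≤ C := by
  have := norm_integral_le_of_norm_le_const (μ := haarU N) (Eventually.of_forall h)
  simpa using this

lemma norm_trace_diagonal_conj_le {N : ℕ} (a b : Fin N → ℂ) (U : UGroup N) :
    ‖Matrix.trace (Matrix.diagonal a * (U : Matrix (Fin N) (Fin N) ℂ) * Matrix.diagonal b *
      ((U⁻¹ : UGroup N) : Matrix (Fin N) (Fin N) ℂ))‖ ≤ N * (N * (‖a‖ * ‖b‖)) := by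
  have h : ∀ i ∈ Finset.univ, ‖(Matrix.diagonal a * (U : Matrix (Fin N) (Fin N) ℂ) *
      Matrix.diagonal b * ((U⁻¹ : UGroup N) : Matrix (Fin N) (Fin N) ℂ)) i i‖ ≤
        N * (‖a‖ * ‖b‖) := fun i _ => by
    rw [Matrix.mul_apply]
    refine (norm_sum_le_of_le (f := fun j => _) Finset.univ (n := fun _ => ‖a‖ * ‖b‖)
      fun j _ => ?_).trans_eq (by simp)
    rw [Matrix.mul_diagonal, Matrix.diagonal_mul, norm_mul, norm_mul, norm_mul]
    calc ‖a i‖ * ‖(U : Matrix (Fin N) (Fin N) ℂ) i j‖ * ‖b j‖ *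
          ‖((U⁻¹ : UGroup N) : Matrix (Fin N) (Fin N) ℂ) j i‖
        ≤ ‖a‖ * 1 * ‖b‖ * 1 := by
          gcongr
          · exact norm_le_pi_norm a i
          · exact entry_norm_bound_of_unitary U.2 i j
          · exact norm_le_pi_norm b j
          · exact entry_norm_bound_of_unitary (U⁻¹).2 j i
      _ = ‖a‖ * ‖b‖ := by ring
  rw [Matrix.trace]
  exact (norm_sum_le_of_le _ h).trans_eq (by simp)

lemma norm_trace_diagonal_mul_le {N : ℕ} (c : Fin N → ℂ) (U : UGroup N) :
    ‖Matrix.trace (Matrix.diagonal c * (U : Matrix (Fin N) (Fin N) ℂ))‖ ≤ N * ‖c‖ := by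
  have h : ∀ i ∈ Finset.univ, ‖(Matrix.diagonal c * (U : Matrix (Fin N) (Fin N) ℂ)) i i‖ ≤
      ‖c‖ := fun i _ => by
    rw [Matrix.diagonal_mul, norm_mul]
    calc ‖c i‖ * ‖(U : Matrix (Fin N) (Fin N) ℂ) i i‖ ≤ ‖c‖ * 1 := by
          gcongr
          · exact norm_le_pi_norm c i
          · exact entry_norm_bound_of_unitary U.2 i i
      _ = ‖c‖ := mul_one _
  rw [Matrix.trace]
  exact (norm_sum_le_of_le _ h).trans_eq (by simp)

/-- The term depends only on the eigenvalue lists, so its moment formula may be evaluated at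
diagonal matrices, where the trace is bounded by N²‖a‖‖b‖. -/
lemma norm_hcizTerm_le {N : ℕ} (hN : 0 < N) (d : ℕ) (x : ℂ × (Fin N → ℂ) × (Fin N → ℂ)) :
    ‖hcizTerm N d x‖ ≤ (‖x.1‖ * N * (N * (N * (‖x.2.1‖ * ‖x.2.2‖)))) ^ d / d.factorial := by
  obtain ⟨z, a, b⟩ := x
  rw [hcizTerm_eq hN d z (isEigenvalueList_diagonal a) (isEigenvalueList_diagonal b), norm_mul,
    norm_div, norm_pow, norm_mul, Complex.norm_natCast, Complex.norm_natCast, mul_pow _ (_ * _),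
    mul_div_right_comm]
  gcongr
  refine norm_integral_haarU_le fun U => ?_
  rw [norm_pow]
  gcongr
  exact norm_trace_diagonal_conj_le a b U

lemma norm_bgwTerm_le {N : ℕ} (hN : 0 < N) (d : ℕ) (x : ℂ × (Fin N → ℂ)) :
    ‖bgwTerm N d x‖ ≤ ((‖x.1‖ * N) ^ 2 * ((N * ‖x.2‖) * N)) ^ d / d.factorial := by
  obtain ⟨z, c⟩ := x
  -- Only the product of the two matrices matters, so `B = 1` is allowed.
  have hc : IsEigenvalueList (Matrix.diagonal c * 1) c := by
    rw [mul_one]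
    exact isEigenvalueList_diagonal c
  have hI : ‖∫ U : UGroup N,
      Matrix.trace (Matrix.diagonal c * (U : Matrix (Fin N) (Fin N) ℂ)) ^ d *
        Matrix.trace (1 * ((U⁻¹ : UGroup N) : Matrix (Fin N) (Fin N) ℂ)) ^ d ∂haarU N‖ ≤
      ((N * ‖c‖) * N) ^ d := by
    refine norm_integral_haarU_le fun U => ?_
    rw [norm_mul, norm_pow, norm_pow, ← mul_pow]
    have h1 : ‖Matrix.trace (1 * ((U⁻¹ : UGroup N) : Matrix (Fin N) (Fin N) ℂ))‖ ≤ N := by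
      have h := norm_trace_diagonal_mul_le (fun _ => 1) U⁻¹
      rw [Matrix.diagonal_one] at h
      refine h.trans (mul_le_of_le_one_right (Nat.cast_nonneg N) ?_)
      exact (pi_norm_le_iff_of_nonneg zero_le_one).2 fun _ => by simp
    gcongr
    exact norm_trace_diagonal_mul_le c U
  have hd : (1 : ℝ) ≤ d.factorial := Nat.one_le_cast.2 (Nat.succ_le_of_lt d.factorial_pos)
  rw [bgwTerm_eq hN d z hc, norm_mul, norm_div, norm_pow, norm_pow, norm_mul,
    Complex.norm_natCast, Complex.norm_natCast, mul_pow (_ ^ 2), ← pow_mul, mul_div_right_comm]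
  -- One of the two factorials is discarded; the other already gives an exponential series.
  have hpow : (d.factorial : ℝ) ≤ (d.factorial : ℝ) ^ 2 := le_self_pow₀ hd two_ne_zero
  gcongr

theorem converges_hcizTerm {N : ℕ} (hN : 0 < N) : ConvergesAbsUnifOnCompacts (hcizTerm N) := by
  refine convergesAbsUnifOnCompacts_of_bound fun K hK => ?_
  obtain ⟨R, hR⟩ := hK.isBounded.exists_norm_le
  refine ⟨R * N * (N * (N * (R * R))), fun d x hx => (norm_hcizTerm_le hN d x).trans ?_⟩
  have h := hR x hx
  have h1 : ‖x.1‖ ≤ R := (norm_fst_le x).trans h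
  have h2 : ‖x.2.1‖ ≤ R := (norm_fst_le x.2).trans ((norm_snd_le x).trans h)
  have h3 : ‖x.2.2‖ ≤ R := (norm_snd_le x.2).trans ((norm_snd_le x).trans h)
  have hR0 : 0 ≤ R := (norm_nonneg _).trans h
  gcongr

theorem converges_bgwTerm {N : ℕ} (hN : 0 < N) : ConvergesAbsUnifOnCompacts (bgwTerm N) := by
  refine convergesAbsUnifOnCompacts_of_bound fun K hK => ?_
  obtain ⟨R, hR⟩ := hK.isBounded.exists_norm_le
  refine ⟨(R * N) ^ 2 * ((N * R) * N), fun d x hx => (norm_bgwTerm_le hN d x).trans ?_⟩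
  have h := hR x hx
  have h1 : ‖x.1‖ ≤ R := (norm_fst_le x).trans h
  have h2 : ‖x.2‖ ≤ R := (norm_snd_le x).trans h
  have hR0 : 0 ≤ R := (norm_nonneg _).trans h
  gcongr

lemma eq_one_add_tsum_of_hasSum {f : ℕ → ℂ} {s : ℂ} (h : HasSum f s) (h0 : f 0 = 1) :
    s = 1 + ∑' d : ℕ, f (d + 1) := by
  rw [← h.tsum_eq, h.summable.tsum_eq_zero_add, h0]

end StringExpansion

end

theorem theorem1p2 (N : ℕ) (hN : 0 < N) :
    (∀ (z : ℂ) (A B : Matrix (Fin N) (Fin N) ℂ) (a b : Fin N → ℂ),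
      StringExpansion.IsEigenvalueList A a → StringExpansion.IsEigenvalueList B b →
        StringExpansion.hciz N z A B =
          1 + ∑' d : ℕ, StringExpansion.hcizTerm N (d + 1) (z, a, b)) ∧
    (∀ (z : ℂ) (A B : Matrix (Fin N) (Fin N) ℂ) (c : Fin N → ℂ),
      StringExpansion.IsEigenvalueList (A * B) c →
        StringExpansion.bgw N z A B =
          1 + ∑' d : ℕ, StringExpansion.bgwTerm N (d + 1) (z, c)) ∧
    StringExpansion.ConvergesAbsUnifOnCompacts (StringExpansion.hcizTerm N) ∧
    StringExpansion.ConvergesAbsUnifOnCompacts (StringExpansion.bgwTerm N) := by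
  refine ⟨fun z A B a b ha hb => ?_, fun z A B c hc => ?_, StringExpansion.converges_hcizTerm hN,
    StringExpansion.converges_bgwTerm hN⟩
  · refine StringExpansion.eq_one_add_tsum_of_hasSum (StringExpansion.hasSum_hciz hN z ha hb) ?_
    -- In degree 0 the moment is the total mass of Haar measure, so the term is 1.
    rw [StringExpansion.hcizTerm_eq hN 0 z ha hb]
    simp
  · refine StringExpansion.eq_one_add_tsum_of_hasSum (StringExpansion.hasSum_bgw hN z hc) ?_
    rw [StringExpansion.bgwTerm_eq hN 0 z hc]
    simp
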